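/- Let $K$ be a field, $\mathrm{vect}_K$ the category of finite dimensional $K$-vector spaces, $J$ a poset (regarded as a category) and $F\colon J\to \mathrm{vect}_K$ a functor. **Conventions.** Let $S$ be a subset of a poset. An *ancestor* of $S$ is a lower bound of $S$; a *sup* of $S$ is a minimal element of the set of upper bounds of $S$; the *coproduct* $\bigvee S$ is the least upper bound of $S$, if it exists. An *upper semilattice* is a poset in which every non-empty finite subset has a coproduct. An order preserving map $f\colon I\to J$ out of an upper semilattice $I$ is a *homomorphism* if, for every non-empty finite $S\subset I$, the element $f(\bigvee_I S)$ is the coproduct of $f(S)$ in $J$. The *parents* of $a$ are the elements covered by $a$; their set is $\mathcal P(a)$. The *parental dimension* $\text{par-dim}_J(a)\in\{0,1,\dots,\infty\}$ is the supremum of $|U|$ over the finite sets $U\subset\{x\in J\mid x<a\}$ that have an ancestor in $J$ and are such that $a$ is a sup of every two-element subset of $U$. A functor $F$ is *discretised* by an order preserving map $f\colon I\to J$ if it is isomorphic to the left Kan extension $f^kG$ along $f$ of some functor $G\colon I\to\mathrm{vect}_K$; $F$ is *tame* if it is discretised by some such $f$ with $I$ finite. A functor $P$ is *free* if it is the left Kan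 extension, along the identity map to $J$ from the set $J$ with the trivial order, of a family $V=\{V_a\}_{a\in J}$ of finite dimensional vector spaces with finite support $\text{supp}(V)=\{a\mid V_a\neq 0\}$; this $V$ is unique up to isomorphism and is called the Betti diagram $\beta P$ of $P$. For $n\in\{1,2,\dots\}\cup\{\infty\}$, an *$n$-resolution* $P\to F$ is an exact sequence $P_{n-1}\to\cdots\to P_0\to F\to 0$ (for $n=\infty$: $\cdots\to P_1\to P_0\to F\to 0$) of functors with all $P_i$ free. It is discretised by $f$ if all $P_i$ are. $F$ is *$n$-resolvable* if it has an $n$-resolution. An $n$-resolution $P\to F$ is *minimal* if every chain map $P\to P$ over $F$ is an isomorphism. The $i$-th Betti diagram $\beta^iF=\{(\beta^iF)_a\}_{a\in J}$ is the Betti diagram of $P_i$, where $P\to F$ is any minimal $n$-resolution with $n>i$. Let $I$ be a finite poset, $a\in I$, $G\colon I\to\mathrm{vect}_K$ a functor, and $\prec$ a linear order on $\mathcal P(a)$. The *Koszul complex* $\mathcal K_aG$ is $G(a)$ in degree $0$, and in degree $k>0$ it is $$\bigoplus_{\substack{S\subset\mathcal P(a),\ |S|=k\\ S\text{ has an ancestor}}}\operatorname{colim}_{\bigcap_{s\in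 S}(I\le s)}G,\qquad (I\le s)=\{x\in I\mid x\le s\}.$$ On the summand $G(s)$ of $(\mathcal K_aG)_1$ indexed by $\{s\}$ the differential is $G(s<a)$. On the summand indexed by $S=\{s_0\prec\cdots\prec s_k\}$ with $k>0$ it is $\sum_{j=0}^k(-1)^j\partial_j$, where $\partial_j$ is the map to the summand indexed by $S\setminus\{s_j\}$ that is induced by the inclusion of the indexing posets of the colimits. **Statement.** 1. Let $n\in\{1,2,\dots\}\cup\{\infty\}$ and let $f\colon I\subset J$ be a subposet inclusion with finite $I$ that discretises an $n$-resolution of $F$. Then $F$ has a minimal $n$-resolution and $\text{supp}(\beta^iF)\subset I$ for all $0\le i<n$. Moreover, for $0\le i<\min(3,n)$ and $a$ in $I$, $(\beta^iF)_a$ is isomorphic to $H_i(\mathcal K_a(Ff))$. 2. Let $F$ be discretised by a subposet inclusion $f\colon I\subset J$ which is a homomorphism out of a finite upper semilattice $I$. Then $F$ is $\infty$-resolvable, $F$ has a minimal $\infty$-resolution, and $\text{supp}(\beta^iF)\subset I$ for all $i\ge 0$. Moreover, for all $i\ge 0$ and $a$ in $I$, $(\beta^iF)_a$ is isomorphic to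 $H_i(\mathcal K_a(Ff))$. 3. Let $J$ be an upper semilattice and $F$ a tame functor. Then $F$ is $\infty$-resolvable, $F$ has a minimal $\infty$-resolution, and $(\beta^iF)_a=0$ for all $a$ in $J$ and $i\ge 0$ with $\text{par-dim}_J(a)<i$. -/

import Mathlib

open CategoryTheory CategoryTheory.Limits

universe u v w

noncomputable section

/-! ## Posets -/

/-- `x` is a *sup* of `S`: an upper bound of `S` with no strictly smaller upper bound of `S`.
(It need not be a least upper bound; a least upper bound, `IsLUB S x`, is the *coproduct* of `S`.) -/
def IsSupOf {I : Type u} [PartialOrder I] (S : Set I) (x : I) : Prop :=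
  Minimal (fun y => y ∈ upperBounds S) x

/-- An upper semilattice: every non-empty finite subset has a coproduct. -/
def IsUpperSemilattice (I : Type u) [PartialOrder I] : Prop :=
  ∀ S : Set I, S.Finite → S.Nonempty → ∃ c, IsLUB S c

/-- A homomorphism out of an upper semilattice: the coproducts of non-empty finite subsets are
sent to coproducts. -/
def IsSemilatticeHom {I : Type u} {J : Type v} [PartialOrder I] [PartialOrder J]
    (f : I → J) : Prop :=
  ∀ S : Set I, S.Finite → S.Nonempty → ∀ c, IsLUB S c → IsLUB (f '' S) (f c)

/-- The set of parents of `a`, i.e. of the elements covered by `a`. -/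
def parents {I : Type u} [PartialOrder I] (a : I) : Set I := {x | x ⋖ a}

/-- The finite sets `U` of elements strictly below `x` that have an ancestor (a lower bound),
and such that `x` is a sup of every two-element subset of `U`. -/
def parDimSets {I : Type u} [PartialOrder I] (x : I) : Set (Finset I) :=
  {U | (∀ y ∈ U, y < x) ∧ (lowerBounds (U : Set I)).Nonempty ∧
    ∀ y ∈ U, ∀ z ∈ U, y ≠ z → IsSupOf {y, z} x}

/-- The parental dimension of `x`. -/
def parDim {I : Type u} [PartialOrder I] (x : I) : ℕ∞ :=
  ⨆ U ∈ parDimSets x, (U.card : ℕ∞)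

/-! ## Discretisation and tameness -/

section Functors

variable {K : Type v} [Field K] {J : Type u} [PartialOrder J]

/-- The restriction `F f` of `F : J ⥤ vect_K` along a monotone map `f : I → J`. -/
abbrev restrictAlong {I : Type w} [PartialOrder I] (f : I →o J) (F : J ⥤ FGModuleCat.{v} K) :
    I ⥤ FGModuleCat.{v} K :=
  f.monotone.functor ⋙ F

/-- `F` is discretised by `f : I → J`: it is a left Kan extension along `f` of some functor `G`. -/
def IsDiscretisedBy {I : Type w} [PartialOrder I] (f : I →o J) (F : J ⥤ FGModuleCat.{v} K) :
    Prop :=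
  ∃ (G : I ⥤ FGModuleCat.{v} K) (α : G ⟶ restrictAlong f F), F.IsLeftKanExtension α

/-- `F` is tame: it is discretised by a monotone map out of a finite poset.  (Every finite poset is
isomorphic to one in `Type`.) -/
def IsTame (F : J ⥤ FGModuleCat.{v} K) : Prop :=
  ∃ (I : Type) (_ : PartialOrder I) (_ : Finite I) (f : I →o J), IsDiscretisedBy f F

/-! ## Free functors, resolutions, Betti diagrams -/

/-- The support of a family of vector spaces. -/
def famSupport (V : J → FGModuleCat.{v} K) : Set J := {a | ¬ IsZero (V a)}

/-- `P` is free and `V` is its Betti diagram: `V` has finite support, and `P` is a left Kan extension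
of `V`, seen as a functor on the set `J` with the trivial order, along the identity map to `J`. -/
def IsFreeOn (P : J ⥤ FGModuleCat.{v} K) (V : J → FGModuleCat.{v} K) : Prop :=
  (famSupport V).Finite ∧
    ∃ α : Discrete.functor V ⟶ Discrete.functor (id : J → J) ⋙ P, P.IsLeftKanExtension α

/-- A (finitely generated) free functor. -/
def IsFree (P : J ⥤ FGModuleCat.{v} K) : Prop := ∃ V, IsFreeOn P V

/-- An `n`-resolution of `F`, where `n` is a natural number or `∞`: an exact sequence
`P (n-1) ⟶ ⋯ ⟶ P 0 ⟶ F ⟶ 0` (resp. `⋯ ⟶ P 1 ⟶ P 0 ⟶ F ⟶ 0`) in the category of functors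
`J ⥤ vect_K`, with all `P i` free.  It is recorded as a non-negative chain complex that is zero in
the degrees `≥ n`; exactness is not required at `P (n-1)`. -/
structure Resolution (F : J ⥤ FGModuleCat.{v} K) (n : ℕ∞) where
  /-- the complex `P` -/
  complex : ChainComplex (J ⥤ FGModuleCat.{v} K) ℕ
  /-- the augmentation `P 0 ⟶ F` -/
  aug : complex.X 0 ⟶ F
  d_aug : complex.d 1 0 ≫ aug = 0
  free : ∀ i : ℕ, (i : ℕ∞) < n → IsFree (complex.X i)
  isZero : ∀ i : ℕ, n ≤ (i : ℕ∞) → IsZero (complex.X i)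
  epi_aug : Epi aug
  exact_zero : 1 < n → (ShortComplex.mk (complex.d 1 0) aug d_aug).Exact
  exact_succ : ∀ i : ℕ, ((i + 2 : ℕ) : ℕ∞) < n → complex.ExactAt (i + 1)

/-- A resolution `P ⟶ F` is minimal if every chain map `P ⟶ P` over `F` is an isomorphism. -/
def Resolution.IsMinimal {F : J ⥤ FGModuleCat.{v} K} {n : ℕ∞} (P : Resolution F n) : Prop :=
  ∀ φ : P.complex ⟶ P.complex, φ.f 0 ≫ P.aug = P.aug → IsIso φ

/-- `F` is `n`-resolvable. -/
def IsResolvable (F : J ⥤ FGModuleCat.{v} K) (n : ℕ∞) : Prop := Nonempty (Resolution F n)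

/-- `F` has a minimal `n`-resolution. -/
def HasMinimalResolution (F : J ⥤ FGModuleCat.{v} K) (n : ℕ∞) : Prop :=
  ∃ P : Resolution F n, P.IsMinimal

/-- `V` is (a representative of) the `i`-th Betti diagram of `F`: the Betti diagram of the `i`-th
term of a minimal `n`-resolution of `F`, for some `n > i`. -/
def IsBettiDiagram (F : J ⥤ FGModuleCat.{v} K) (i : ℕ) (V : J → FGModuleCat.{v} K) : Prop :=
  ∃ (n : ℕ∞) (P : Resolution F n), (i : ℕ∞) < n ∧ P.IsMinimal ∧ IsFreeOn (P.complex.X i) V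

end Functors

/-! ## The Koszul complex of a functor on a finite poset -/

namespace Koszul

variable {K : Type v} [Field K] {I : Type u} [PartialOrder I]

/-- The restriction of `G` to a subposet `A`. -/
abbrev restrict (G : I ⥤ FGModuleCat.{v} K) (A : Set I) : A ⥤ FGModuleCat.{v} K :=
  (Subtype.mono_coe (fun x => x ∈ A)).functor ⋙ G

instance [Finite I] (A : Set I) : HasColimitsOfShape A (FGModuleCat.{v} K) :=
  have : Fintype A := Fintype.ofFinite A
  inferInstance

variable [Finite I] (G : I ⥤ FGModuleCat.{v} K)

/-- `colim_A G`. -/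
def colimOn (A : Set I) : FGModuleCat.{v} K := colimit (restrict G A)

/-- The structure map `G x ⟶ colim_A G` for `x` in `A`. -/
def colimι (A : Set I) (x : A) : G.obj x ⟶ colimOn G A := colimit.ι (restrict G A) x

theorem map_colimι (A : Set I) (x y : A) (h : (x : I) ≤ y) :
    G.map (homOfLE h) ≫ colimι G A y = colimι G A x :=
  colimit.w (restrict G A) (homOfLE h : x ⟶ y)

/-- The map `colim_A G ⟶ W` defined by a compatible family. -/
def colimDesc (A : Set I) {W : FGModuleCat.{v} K} (φ : ∀ x : A, G.obj x ⟶ W)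
    (hφ : ∀ (x y : A) (h : (x : I) ≤ y), G.map (homOfLE h) ≫ φ y = φ x) : colimOn G A ⟶ W :=
  colimit.desc (restrict G A)
    { pt := W
      ι := { app := φ
             naturality := fun x y h => by
              simpa using! hφ x y (leOfHom h) } }

theorem colimι_desc (A : Set I) {W : FGModuleCat.{v} K} (φ : ∀ x : A, G.obj x ⟶ W)
    (hφ : ∀ (x y : A) (h : (x : I) ≤ y), G.map (homOfLE h) ≫ φ y = φ x) (x : A) :
    colimι G A x ≫ colimDesc G A φ hφ = φ x :=
  colimit.ι_desc _ _

theorem colim_hom_ext {A : Set I} {W : FGModuleCat.{v} K} {φ ψ : colimOn G A ⟶ W}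
    (h : ∀ x : A, colimι G A x ≫ φ = colimι G A x ≫ ψ) : φ = ψ :=
  colimit.hom_ext h

/-- The map of colimits `colim_A G ⟶ colim_B G` induced by an inclusion `A ⊆ B`. -/
def colimMap {A B : Set I} (h : A ⊆ B) : colimOn G A ⟶ colimOn G B :=
  colimDesc G A (fun x => colimι G B ⟨x, h x.2⟩) (fun x y hxy => map_colimι G B ⟨x, h x.2⟩ ⟨y, h y.2⟩ hxy)

/-- The map `colim_A G ⟶ G a` given by the maps `G (x ≤ a)`, if `a` is an upper bound of `A`. -/
def colimTo {A : Set I} {a : I} (h : ∀ x ∈ A, x ≤ a) : colimOn G A ⟶ G.obj a :=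
  colimDesc G A (fun x => G.map (homOfLE (h x x.2)))
    (fun x y hxy => by rw [← G.map_comp]; rfl)

theorem ι_colimMap {A B : Set I} (h : A ⊆ B) (x : A) :
    colimι G A x ≫ colimMap G h = colimι G B ⟨x, h x.2⟩ :=
  colimι_desc G A (fun x : A => colimι G B ⟨x, h x.2⟩) _ x

theorem ι_colimTo {A : Set I} {a : I} (h : ∀ x ∈ A, x ≤ a) (x : A) :
    colimι G A x ≫ colimTo G h = G.map (homOfLE (h x x.2)) :=
  colimι_desc _ _ _ _ _

theorem colimMap_comp {A B C : Set I} (h : A ⊆ B) (h' : B ⊆ C) :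
    colimMap G h ≫ colimMap G h' = colimMap G (h.trans h') := by
  apply colim_hom_ext
  intro x
  rw [← Category.assoc, ι_colimMap, ι_colimMap, ι_colimMap]

theorem colimMap_colimTo {A B : Set I} {a : I} (h : A ⊆ B) (h' : ∀ x ∈ B, x ≤ a) :
    colimMap G h ≫ colimTo G h' = colimTo G (fun x hx => h' x (h hx)) := by
  apply colim_hom_ext
  intro x
  rw [← Category.assoc, ι_colimMap, ι_colimTo, ι_colimTo]

/-! A linear ordering of the finite set of parents of `a` is given as an enumeration
`e : Fin m ≃ parents a`.  A subset `S = {s_0 ≺ ⋯ ≺ s_{k-1}}` of size `k` of the set of parents then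
is a strictly increasing map `σ : Fin k ↪o Fin m`, with `s_j = e (σ j)`. -/

variable {a : I} {m : ℕ} (e : Fin m ≃ parents a)

/-- The subposet `⋂_{s ∈ S} (I ≤ s)` of the ancestors of `S`. -/
def ancestors {k : ℕ} (σ : Fin k ↪o Fin m) : Set I :=
  lowerBounds (Set.range fun j => (e (σ j) : I))

/-- The subsets `S` of size `k` of the set of parents of `a` that have an ancestor. -/
structure Index (k : ℕ) where
  /-- the subset -/
  emb : Fin k ↪o Fin m
  nonempty : (ancestors e emb).Nonempty

instance (k : ℕ) : Finite (Index e k) := by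
  refine Finite.of_injective (fun σ : Index e k => (σ.emb : Fin k → Fin m)) ?_
  rintro ⟨σ, _⟩ ⟨τ, _⟩ h
  obtain rfl : σ = τ := DFunLike.coe_injective h
  rfl

theorem ancestors_face {k : ℕ} (σ : Fin (k + 1) ↪o Fin m) (j : Fin (k + 1)) :
    ancestors e σ ⊆ ancestors e ((Fin.succAboveOrderEmb j).trans σ) := by
  apply lowerBounds_mono_set
  rintro _ ⟨i, rfl⟩
  exact ⟨_, rfl⟩

/-- The subset `S \ {s_j}`. -/
def Index.face {k : ℕ} (σ : Index e (k + 1)) (j : Fin (k + 1)) : Index e k :=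
  ⟨(Fin.succAboveOrderEmb j).trans σ.emb, σ.nonempty.mono (ancestors_face e σ.emb j)⟩

theorem Index.ancestors_face {k : ℕ} (σ : Index e (k + 1)) (j : Fin (k + 1)) :
    ancestors e σ.emb ⊆ ancestors e (σ.face e j).emb :=
  Koszul.ancestors_face e σ.emb j

theorem Index.le_of_mem {k : ℕ} (σ : Index e (k + 1)) : ∀ x ∈ ancestors e σ.emb, x ≤ a :=
  fun _ hx => (hx ⟨0, rfl⟩).trans (e (σ.emb 0)).2.le

/-- The direct sum, over the subsets `S` of size `k` that have an ancestor, of the vector spaces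
`colim_{⋂_{s ∈ S} (I ≤ s)} G`. -/
def term (k : ℕ) : FGModuleCat.{v} K := ∐ fun σ : Index e k => colimOn G (ancestors e σ.emb)

/-- The inclusion of the summand indexed by `S`. -/
def termι {k : ℕ} (σ : Index e k) : colimOn G (ancestors e σ.emb) ⟶ term G e k :=
  Sigma.ι (fun σ : Index e k => colimOn G (ancestors e σ.emb)) σ

/-- The map out of the direct sum that is given by `φ` on the summands. -/
def termDesc {k : ℕ} {W : FGModuleCat.{v} K}
    (φ : ∀ σ : Index e k, colimOn G (ancestors e σ.emb) ⟶ W) : term G e k ⟶ W :=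
  Sigma.desc φ

theorem termι_desc {k : ℕ} {W : FGModuleCat.{v} K}
    (φ : ∀ σ : Index e k, colimOn G (ancestors e σ.emb) ⟶ W) (σ : Index e k) :
    termι G e σ ≫ termDesc G e φ = φ σ :=
  Sigma.ι_desc φ σ

theorem term_hom_ext {k : ℕ} {W : FGModuleCat.{v} K} {φ ψ : term G e k ⟶ W}
    (h : ∀ σ : Index e k, termι G e σ ≫ φ = termι G e σ ≫ ψ) : φ = ψ :=
  Sigma.hom_ext φ ψ h

/-- The map of the summand indexed by `S` to the summand indexed by `S \ {s_j}`. -/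
def faceMap {k : ℕ} (σ : Index e (k + 1)) (j : Fin (k + 1)) :
    colimOn G (ancestors e σ.emb) ⟶ term G e k :=
  colimMap G (σ.ancestors_face e j) ≫ termι G e (σ.face e j)

/-- The differential `∂ = ∑_j (-1)^j ∂_j`, from the subsets of size `k + 1` to those of size `k`. -/
def diff (k : ℕ) : term G e (k + 1) ⟶ term G e k :=
  termDesc G e fun σ => ∑ j : Fin (k + 1), (-1 : ℤ) ^ (j : ℕ) • faceMap G e σ j

/-- The differential to `G a` from the sum indexed by the subsets of size `1`, which on the
summand indexed by `{s}` is given by `G (s < a)`. -/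
def diffZero : term G e 1 ⟶ G.obj a :=
  termDesc G e fun σ => colimTo G (σ.le_of_mem e)

theorem face_face {k : ℕ} (σ : Index e (k + 2)) (i : Fin (k + 1)) (j : Fin (k + 2))
    (h : (j : ℕ) ≤ i) :
    (σ.face e j).face e i = (σ.face e i.succ).face e (Fin.castLT j (by omega)) := by
  have key : ((σ.face e j).face e i).emb =
      ((σ.face e i.succ).face e (Fin.castLT j (by omega))).emb := by
    apply DFunLike.ext
    intro x
    change σ.emb (j.succAbove (i.succAbove x)) =
      σ.emb (i.succ.succAbove ((Fin.castLT j (by omega) : Fin (k + 1)).succAbove x))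
    congr 1
    simp only [Fin.succAbove, Fin.lt_def, Fin.ext_iff]
    split_ifs <;> simp_all <;> omega
  generalize (σ.face e j).face e i = s at key
  generalize (σ.face e i.succ).face e _ = t at key
  cases s
  cases t
  cases key
  rfl

theorem map_ι_congr {k : ℕ} {A : Set I} {σ τ : Index e k} (h : σ = τ)
    (hσ : A ⊆ ancestors e σ.emb) (hτ : A ⊆ ancestors e τ.emb) :
    colimMap G hσ ≫ termι G e σ = colimMap G hτ ≫ termι G e τ := by
  subst h; rfl

theorem faceMap_diff {k : ℕ} (σ : Index e (k + 2)) (j : Fin (k + 2)) :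
    faceMap G e σ j ≫ diff G e k = ∑ i : Fin (k + 1), (-1 : ℤ) ^ (i : ℕ) •
      (colimMap G ((σ.ancestors_face e j).trans ((σ.face e j).ancestors_face e i)) ≫
        termι G e ((σ.face e j).face e i)) := by
  rw [faceMap, diff, Category.assoc, termι_desc, Preadditive.comp_sum]
  refine Finset.sum_congr rfl fun i _ => ?_
  rw [Preadditive.comp_zsmul, faceMap, ← Category.assoc, colimMap_comp]

theorem diff_diff (k : ℕ) : diff G e (k + 1) ≫ diff G e k = 0 := by
  apply term_hom_ext
  intro σ
  rw [comp_zero, ← Category.assoc]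
  rw [show termι G e σ ≫ diff G e (k + 1) =
    ∑ j : Fin (k + 2), (-1 : ℤ) ^ (j : ℕ) • faceMap G e σ j from termι_desc _ _ _ _]
  simp only [Preadditive.sum_comp, Preadditive.zsmul_comp, faceMap_diff, Finset.smul_sum,
    smul_smul]
  rw [Finset.sum_comm]
  simp only [← Finset.sum_product']
  let P := Fin (k + 1) × Fin (k + 2)
  let S : Finset P := {ij : P | (ij.2 : ℕ) ≤ (ij.1 : ℕ)}
  rw [Finset.univ_product_univ, ← Finset.sum_add_sum_compl S, ← eq_neg_iff_add_eq_zero,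
    ← Finset.sum_neg_distrib]
  let φ : ∀ ij : P, ij ∈ S → P := fun ij hij =>
    (Fin.castLT ij.2 (lt_of_le_of_lt (Finset.mem_filter.mp hij).right (Fin.is_lt ij.1)), ij.1.succ)
  apply Finset.sum_bij φ
  · intro ij hij
    simp_rw [S, φ, Finset.compl_filter, Finset.mem_filter_univ, Fin.val_succ,
      Fin.val_castLT] at hij ⊢
    omega
  · rintro ⟨i, j⟩ hij ⟨i', j'⟩ hij' h
    rw [Prod.mk_inj]
    exact ⟨by simpa [φ] using! congr_arg Prod.snd h,
      by simpa [φ, Fin.castSucc_castLT] using! congr_arg Fin.castSucc (congr_arg Prod.fst h)⟩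
  · rintro ⟨i', j'⟩ hij'
    simp_rw [S, Finset.compl_filter, Finset.mem_filter_univ, not_le] at hij'
    refine ⟨(j'.pred <| ?_, Fin.castSucc i'), ?_, ?_⟩
    · rintro rfl
      simp only [Fin.val_zero, not_lt_zero] at hij'
    · simpa [S] using! Nat.le_sub_one_of_lt hij'
    · simp only [φ, Fin.castLT_castSucc, Fin.succ_pred]
  · rintro ⟨i, j⟩ hij
    have hji : (j : ℕ) ≤ i := by simpa [S] using! hij
    rw [map_ι_congr G e (face_face e σ i j hji) _
      ((σ.ancestors_face e _).trans ((σ.face e _).ancestors_face e _)), ← neg_smul]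
    congr 1
    simp only [φ, Fin.val_succ, Fin.val_castLT, pow_add, pow_one]
    ring

theorem diff_diffZero : diff G e 1 ≫ diffZero G e = 0 := by
  apply term_hom_ext
  intro σ
  rw [comp_zero, ← Category.assoc]
  rw [show termι G e σ ≫ diff G e 1 =
    ∑ j : Fin 2, (-1 : ℤ) ^ (j : ℕ) • faceMap G e σ j from termι_desc _ _ _ _]
  have key : ∀ j : Fin 2, faceMap G e σ j ≫ diffZero G e = colimTo G (σ.le_of_mem e) := by
    intro j
    rw [faceMap, diffZero, Category.assoc, termι_desc, colimMap_colimTo]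
  simp [Fin.sum_univ_two, Preadditive.add_comp, key]

/-- The Koszul complex of `G` at `a`: it is `G a` in degree `0`, and in degree `k > 0` the direct sum
of the colimits `colim_{⋂_{s ∈ S} (I ≤ s)} G` over the sets `S` of `k` parents of `a` that have an
ancestor. -/
def koszulComplex : ChainComplex (FGModuleCat.{v} K) ℕ :=
  ChainComplex.augment
    (ChainComplex.of (fun k => term G e (k + 1)) (fun k => diff G e (k + 1))
      (fun k => diff_diff G e (k + 1)))
    (diffZero G e)
    ((congrArg (fun φ : term G e 2 ⟶ term G e 1 => φ ≫ diffZero G e)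
      (ChainComplex.of_d (fun k => term G e (k + 1)) (fun k => diff G e (k + 1)) 0)).trans
      (diff_diffZero G e))

end Koszul

end

noncomputable section

/-! ## Elementwise criteria in `FGModuleCat` and in functor categories -/

section Elementwise

variable {K : Type v} [Field K]

/-! Free functors are projective, and over a field minimality of a cover is a radical condition:
`freeOn.IsRadical p` says that an element of `ker p` at the position of a generator has coefficient
zero at that generator. Every finitely generated functor has a radical cover
(`freeOn.exists_isRadical`), radical covers are right minimal, and a resolution is minimal exactly
when each term up to its length is right minimal over the preceding one
(`Resolution.IsMinimal.rightMinimal_dd`, `Resolution.isMinimal_of_rightMinimal_dd`). Minimal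
resolutions are therefore spliced from radical covers, as soon as each syzygy is again covered by a
free functor with generators in a set `A`.

`IsSyzygyProperty` isolates what is needed for this. There are two instances. If a resolution
generated on `A` is given, the property is to be a retract of its `k`-th syzygy: minimal syzygies
split off from arbitrary ones. If below each element of `J` that lies above some element of `A`
there is a greatest element of `A`, the property is `IsDeterminedOn A`: the value at `j` is the
value at the greatest element of `A` below `j`. It holds for functors discretised by a map into `A`,
and kernels inherit it. The image of a homomorphism out of a finite upper semilattice is such a set
`A`. A tame functor on an upper semilattice is reduced to this case by closing the image of the
discretising map under joins.

The Koszul complex is computed by dimension shifting. On a free functor it splits over the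
generators into augmented chain complexes of full simplices, spanned by the parents above a
generator; hence it is acyclic in positive degrees (`Koszul.exactAt_koszulComplex_freeOn`), and
`H_0` is spanned by the generators at `a`. Let `0 → N → P → M → 0` be exact with `P → M` radical.
Colimits being right exact, the Koszul complexes form a right exact sequence, and radicality makes
`H_0 N → H_0 P` vanish. If moreover the colimits in degrees `≤ i` are over posets with a greatest
element, they are evaluations, left exactness holds there, and `H_{i+1} M ≅ H_i N`
(`Koszul.nonempty_homology_succ_iso`). Iterating, `H_i` of `F` becomes `H_0` of the `i`-th syzygy,
whose dimension counts the generators at `a` in the `i`-th term. Degrees `≤ 1` always satisfy the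
condition, which yields `i ≤ 2`; in an upper semilattice all degrees do. Finally, a set of parents
in the join closure that has an ancestor has at most `parDim` elements, so the complex is zero above
that degree. -/

theorem FGModuleCat.epi_iff_surjective' {V W : FGModuleCat.{v} K} (f : V ⟶ W) :
    Epi f ↔ Function.Surjective f.hom.hom := by
  rw [← (forget₂ (FGModuleCat.{v} K) (ModuleCat.{v} K)).epi_map_iff_epi,
    ModuleCat.epi_iff_surjective]
  rfl

theorem FGModuleCat.mono_iff_injective' {V W : FGModuleCat.{v} K} (f : V ⟶ W) :
    Mono f ↔ Function.Injective f.hom.hom := by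
  rw [← (forget₂ (FGModuleCat.{v} K) (ModuleCat.{v} K)).mono_map_iff_mono,
    ModuleCat.mono_iff_injective]
  rfl

theorem FGModuleCat.exact_iff_function_exact (S : ShortComplex (FGModuleCat.{v} K)) :
    S.Exact ↔ Function.Exact S.f.hom.hom S.g.hom.hom := by
  rw [← S.exact_map_iff_of_faithful (forget₂ (FGModuleCat.{v} K) (ModuleCat.{v} K)),
    ShortComplex.ShortExact.moduleCat_exact_iff_function_exact]
  rfl

theorem FGModuleCat.isZero_iff_subsingleton (V : FGModuleCat.{v} K) :
    IsZero V ↔ Subsingleton V := by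
  rw [IsZero.iff_id_eq_zero]
  constructor
  · intro h
    refine ⟨fun x y => ?_⟩
    have hz : ∀ z : V, z = 0 := fun z =>
      congrArg (fun φ : V ⟶ V => φ.hom.hom z) h
    rw [hz x, hz y]
  · intro h
    apply FGModuleCat.hom_ext
    apply LinearMap.ext
    intro x
    exact Subsingleton.elim _ _

theorem FGModuleCat.hom_apply_eq {V W : FGModuleCat.{v} K} {f g : V ⟶ W} (h : f = g) (x : V) :
    f.hom.hom x = g.hom.hom x := by rw [h]

theorem FGModuleCat.nonempty_iso_of_finrank_eq {V W : FGModuleCat.{v} K}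
    (h : Module.finrank K V = Module.finrank K W) : Nonempty (V ≅ W) :=
  ⟨(LinearEquiv.ofFinrankEq V W h).toFGModuleCatIso⟩

theorem FGModuleCat.isIso_of_bijective {V W : FGModuleCat.{v} K} (f : V ⟶ W)
    (h : Function.Bijective f.hom.hom) : IsIso f := by
  have := (FGModuleCat.mono_iff_injective' f).2 h.1
  have := (FGModuleCat.epi_iff_surjective' f).2 h.2
  exact isIso_of_mono_of_epi f

variable {J : Type u} [PartialOrder J] {M N : J ⥤ FGModuleCat.{v} K}

theorem functor_epi_iff_surjective (p : M ⟶ N) :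
    Epi p ↔ ∀ j, Function.Surjective (p.app j).hom.hom := by
  simp only [NatTrans.epi_iff_epi_app, FGModuleCat.epi_iff_surjective']

theorem functor_mono_iff_injective (p : M ⟶ N) :
    Mono p ↔ ∀ j, Function.Injective (p.app j).hom.hom := by
  simp only [NatTrans.mono_iff_mono_app, FGModuleCat.mono_iff_injective']

theorem functor_exact_app {S : ShortComplex (J ⥤ FGModuleCat.{v} K)} (hS : S.Exact) (j : J) :
    Function.Exact (S.f.app j).hom.hom (S.g.app j).hom.hom :=
  (FGModuleCat.exact_iff_function_exact _).1
    (hS.map ((evaluation J (FGModuleCat.{v} K)).obj j))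

theorem map_hom_refl (M : J ⥤ FGModuleCat.{v} K) {a : J} (h : a ⟶ a) (x : M.obj a) :
    (M.map h).hom.hom x = x :=
  FGModuleCat.hom_apply_eq (M.map_id a) x

theorem map_hom_map_hom (M : J ⥤ FGModuleCat.{v} K) {a b c : J} (h : a ⟶ b) (h' : b ⟶ c)
    (h'' : a ⟶ c) (x : M.obj a) :
    (M.map h').hom.hom ((M.map h).hom.hom x) = (M.map h'').hom.hom x := by
  rw [show h'' = h ≫ h' from Subsingleton.elim _ _, M.map_comp]
  rfl

theorem app_hom_map_hom (p : M ⟶ N) {a b : J} (h : a ⟶ b) (x : M.obj a) :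
    (p.app b).hom.hom ((M.map h).hom.hom x) = (N.map h).hom.hom ((p.app a).hom.hom x) :=
  FGModuleCat.hom_apply_eq (p.naturality h) x

end Elementwise

/-! ## The free functor on a finite family of elements -/

section Free

variable (K : Type v) [Field K] {J : Type u} [PartialOrder J]

/-- The coefficient vectors supported on the generators that are `≤ j`. -/
def supportedBelow {n : ℕ} (x : Fin n → J) (j : J) : Submodule K (Fin n → K) where
  carrier := {c | ∀ i, ¬ x i ≤ j → c i = 0}
  add_mem' := fun {c d} hc hd i hi => by simp [hc i hi, hd i hi]
  zero_mem' := fun _ _ => rfl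
  smul_mem' := fun r c hc i hi => by simp [hc i hi]

theorem supportedBelow_mono {n : ℕ} (x : Fin n → J) {j k : J} (h : j ≤ k) :
    supportedBelow K x j ≤ supportedBelow K x k :=
  fun _ hc i hi => hc i fun h' => hi (h'.trans h)

/-- The free functor with one generator at each `x i`: its value at `j` is the space of
coefficient vectors supported on the generators that are `≤ j`. -/
def freeOn {n : ℕ} (x : Fin n → J) : J ⥤ FGModuleCat.{v} K where
  obj j := FGModuleCat.of K (supportedBelow K x j)
  map h := FGModuleCat.ofHom (Submodule.inclusion (supportedBelow_mono K x (leOfHom h)))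
  map_id _ := rfl
  map_comp _ _ := rfl

namespace freeOn

variable {K} {n : ℕ} (x : Fin n → J)

/-- The coefficient vector of an element of a free functor. -/
def coeff {j : J} : (freeOn K x).obj j →ₗ[K] (Fin n → K) := (supportedBelow K x j).subtype

theorem coeff_injective {j : J} : Function.Injective (coeff (K := K) x (j := j)) :=
  Subtype.val_injective

theorem coeff_eq_zero {j : J} (c : (freeOn K x).obj j) {i : Fin n} (h : ¬ x i ≤ j) :
    coeff x c i = 0 :=
  Subtype.property (p := fun c => c ∈ supportedBelow K x j) c i h

@[simp]
theorem coeff_map {j k : J} (h : j ⟶ k) (c : (freeOn K x).obj j) :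
    coeff x (((freeOn K x).map h).hom.hom c) = coeff x c := rfl

/-- The element with a given coefficient vector. -/
def mk {j : J} (c : Fin n → K) (hc : ∀ i, ¬ x i ≤ j → c i = 0) : (freeOn K x).obj j :=
  (⟨c, hc⟩ : supportedBelow K x j)

@[simp]
theorem coeff_mk {j : J} (c : Fin n → K) (hc : ∀ i, ¬ x i ≤ j → c i = 0) :
    coeff x (mk x c hc) = c := rfl

/-- The `i`-th generator. -/
def gen (i : Fin n) : (freeOn K x).obj (x i) :=
  mk x (Pi.single i 1) fun k hk => Pi.single_eq_of_ne (by rintro rfl; exact hk le_rfl) _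

@[simp]
theorem coeff_gen (i : Fin n) : coeff (K := K) x (gen x i) = Pi.single i 1 := rfl

variable (M : J ⥤ FGModuleCat.{v} K)

open Classical in
/-- The image at `j` of an element at `a`, if `a ≤ j`, and zero otherwise. -/
def transport {a : J} (p : M.obj a) (j : J) : M.obj j :=
  if h : a ≤ j then (M.map (homOfLE h)).hom.hom p else 0

variable {M}

theorem transport_of_le {a j : J} (p : M.obj a) (h : a ≤ j) :
    transport M p j = (M.map (homOfLE h)).hom.hom p := dif_pos h

theorem transport_of_not_le {a j : J} (p : M.obj a) (h : ¬ a ≤ j) :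
    transport M p j = 0 := dif_neg h

theorem app_transport {N : J ⥤ FGModuleCat.{v} K} (φ : M ⟶ N) {a j : J} (p : M.obj a) :
    (φ.app j).hom.hom (transport M p j) = transport N ((φ.app a).hom.hom p) j := by
  by_cases h : a ≤ j
  · rw [transport_of_le p h, transport_of_le _ h, app_hom_map_hom]
  · rw [transport_of_not_le p h, transport_of_not_le _ h, map_zero]

theorem coeff_transport_gen (i : Fin n) {j : J} (h : x i ≤ j) :
    coeff (K := K) x (transport _ (gen x i) j) = Pi.single i 1 := by
  rw [transport_of_le _ h]; rfl

theorem eq_sum {j : J} (c : (freeOn K x).obj j) :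
    c = ∑ i, coeff x c i • transport _ (gen x i) j := by
  apply coeff_injective x
  rw [map_sum]
  ext k
  rw [Finset.sum_apply, Finset.sum_eq_single k]
  · by_cases h : x k ≤ j
    · simp [coeff_transport_gen x k h]
    · simp [coeff_eq_zero x c h]
  · intro i _ hi
    by_cases h : x i ≤ j
    · simp [coeff_transport_gen x i h, hi.symm]
    · simp [coeff_eq_zero x c h]
  · simp

/-- The morphism out of a free functor defined by the images of the generators. -/
def lift (p : ∀ i, M.obj (x i)) : freeOn K x ⟶ M where
  app j := FGModuleCat.ofHom (V := supportedBelow K x j) (W := M.obj j)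
    (∑ i, (LinearMap.proj i ∘ₗ coeff x).smulRight (transport M (p i) j))
  naturality j k h := by
    apply FGModuleCat.hom_ext
    apply LinearMap.ext
    intro c
    change (∑ i, (LinearMap.proj i ∘ₗ coeff x).smulRight (transport M (p i) k)) _ =
      (M.map h).hom.hom ((∑ i, (LinearMap.proj i ∘ₗ coeff x).smulRight (transport M (p i) j)) c)
    rw [LinearMap.sum_apply, LinearMap.sum_apply, map_sum]
    refine Finset.sum_congr rfl fun i _ => ?_
    change coeff x (((freeOn K x).map h).hom.hom c) i • _ = (M.map h).hom.hom (coeff x c i • _)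
    rw [coeff_map, map_smul]
    by_cases hi : x i ≤ j
    · rw [transport_of_le _ hi, transport_of_le _ (hi.trans (leOfHom h)), map_hom_map_hom]
    · rw [coeff_eq_zero x c hi, zero_smul, zero_smul]

theorem lift_apply (p : ∀ i, M.obj (x i)) {j : J} (c : (freeOn K x).obj j) :
    ((lift x p).app j).hom.hom c = ∑ i, coeff x c i • transport M (p i) j := by
  change (∑ i, (LinearMap.proj i ∘ₗ coeff x).smulRight (transport M (p i) j)) c = _
  rw [LinearMap.sum_apply]
  rfl

theorem app_apply (φ : freeOn K x ⟶ M) {j : J} (c : (freeOn K x).obj j) :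
    (φ.app j).hom.hom c =
      ∑ i, coeff x c i • transport M ((φ.app (x i)).hom.hom (gen x i)) j := by
  conv_lhs => rw [eq_sum x c]
  rw [map_sum]
  refine Finset.sum_congr rfl fun i _ => ?_
  rw [map_smul, app_transport]

theorem hom_ext {φ ψ : freeOn K x ⟶ M}
    (h : ∀ i, (φ.app (x i)).hom.hom (gen x i) = (ψ.app (x i)).hom.hom (gen x i)) : φ = ψ := by
  ext j : 2
  apply FGModuleCat.hom_ext
  apply LinearMap.ext
  intro c
  rw [app_apply, app_apply]
  simp_rw [h]

@[simp]
theorem lift_gen (p : ∀ i, M.obj (x i)) (i : Fin n) :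
    ((lift x p).app (x i)).hom.hom (gen x i) = p i := by
  rw [lift_apply, Finset.sum_eq_single i]
  · rw [coeff_gen, Pi.single_eq_same, one_smul, transport_of_le _ le_rfl, map_hom_refl]
  · intro k _ hk
    rw [coeff_gen, Pi.single_eq_of_ne hk, zero_smul]
  · simp

instance : Projective (freeOn K x) where
  factors {M N} f q hq := by
    have hs := (functor_epi_iff_surjective q).1 hq
    choose s hs' using fun i => hs (x i) ((f.app (x i)).hom.hom (gen x i))
    refine ⟨lift x s, hom_ext x fun i => ?_⟩
    change (q.app (x i)).hom.hom (((lift x s).app (x i)).hom.hom (gen x i)) = _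
    rw [lift_gen, hs']

end freeOn

end Free

/-! ## Right minimal morphisms and radical covers -/

/-- A morphism `p : P ⟶ M` is right minimal if every endomorphism of `P` over `M` is an
isomorphism. -/
def RightMinimal {C : Type*} [Category C] {P M : C} (p : P ⟶ M) : Prop :=
  ∀ φ : P ⟶ P, φ ≫ p = p → IsIso φ

namespace RightMinimal

variable {C : Type*} [Category C] {P P' M M' : C}

theorem comp_mono {p : P ⟶ M} (h : RightMinimal p) (i : M ⟶ M') [Mono i] :
    RightMinimal (p ≫ i) := fun φ hφ =>
  h φ (by rwa [← Category.assoc, cancel_mono] at hφ)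

theorem of_comp {p : P ⟶ M} {i : M ⟶ M'} (h : RightMinimal (p ≫ i)) :
    RightMinimal p := fun φ hφ => h φ (by rw [← Category.assoc, hφ])

/-- Two right minimal covers that factor through each other are isomorphic. -/
theorem exists_iso {p : P ⟶ M} {p' : P' ⟶ M} (h : RightMinimal p) (h' : RightMinimal p')
    (u : P ⟶ P') (hu : u ≫ p' = p) (v : P' ⟶ P) (hv : v ≫ p = p') :
    ∃ e : P ≅ P', e.hom ≫ p' = p := by
  have h1 := h (u ≫ v) (by rw [Category.assoc, hv, hu])
  have h2 := h' (v ≫ u) (by rw [Category.assoc, hu, hv])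
  have : IsSplitMono u := IsSplitMono.mk' ⟨v ≫ inv (u ≫ v), by simp [← Category.assoc]⟩
  have : Epi u := by
    have : Epi (v ≫ u) := inferInstance
    exact epi_of_epi v u
  have : IsIso u := isIso_of_epi_of_isSplitMono u
  exact ⟨asIso u, hu⟩

end RightMinimal

namespace freeOn

variable {K : Type v} [Field K] {J : Type u} [PartialOrder J]
  {M : J ⥤ FGModuleCat.{v} K}

theorem coeff_app {n m : ℕ} {x : Fin n → J} {y : Fin m → J} (φ : freeOn K y ⟶ freeOn K x) {j : J}
    (c : (freeOn K y).obj j) (k : Fin n) :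
    coeff x ((φ.app j).hom.hom c) k =
      ∑ i, coeff y c i * coeff x ((φ.app (y i)).hom.hom (gen y i)) k := by
  rw [app_apply, map_sum, Finset.sum_apply]
  refine Finset.sum_congr rfl fun i _ => ?_
  rw [map_smul, Pi.smul_apply, smul_eq_mul]
  by_cases h : y i ≤ j
  · rw [transport_of_le _ h, coeff_map]
  · rw [coeff_eq_zero y c h, zero_mul, zero_mul]

/-- The kernel of `p` lies in the radical: no element of the kernel involves a generator that
sits at the same place as the element. -/
def IsRadical {n : ℕ} {x : Fin n → J} (p : freeOn K x ⟶ M) : Prop :=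
  ∀ (i : Fin n) (c : (freeOn K x).obj (x i)), (p.app (x i)).hom.hom c = 0 → coeff x c i = 0

/-- An endomorphism over `M` is unitriangular for the order of positions: `φ` moves each generator
by an element of `ker p`, so radicality makes it the identity among generators at the same place. It
is thus injective at each `j`, hence bijective by finite dimension. -/
theorem IsRadical.rightMinimal {n : ℕ} {x : Fin n → J} {p : freeOn K x ⟶ M} (hp : IsRadical p) :
    RightMinimal p := by
  classical
  intro φ hφ
  have hr : ∀ i k, ¬ x i < x k → coeff x ((φ.app (x k)).hom.hom (gen x k)) i =
      Pi.single (M := fun _ => K) k 1 i := by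
    intro i k hik
    by_cases hxi : x i ≤ x k
    · have hxi : x i = x k := hxi.eq_of_not_lt hik
      have h0 := hp i (((freeOn K x).map (homOfLE hxi.ge)).hom.hom
        ((φ.app (x k)).hom.hom (gen x k) - gen x k)) (by
          have h : (p.app (x k)).hom.hom ((φ.app (x k)).hom.hom (gen x k)) =
              (p.app (x k)).hom.hom (gen x k) :=
            FGModuleCat.hom_apply_eq (congrArg (·.app (x k)) hφ) _
          rw [app_hom_map_hom, map_sub, h, sub_self, map_zero])
      rw [coeff_map, map_sub, Pi.sub_apply, sub_eq_zero] at h0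
      rw [h0, coeff_gen]
    · rw [coeff_eq_zero x _ hxi, Pi.single_eq_of_ne]
      rintro rfl
      exact hxi le_rfl
  have hinj : ∀ j, Function.Injective (φ.app j).hom.hom := by
    intro j
    rw [injective_iff_map_eq_zero]
    intro c hc
    by_contra hne
    have hex : ({i | coeff x c i ≠ 0} : Finset (Fin n)).Nonempty := by
      by_contra hemp
      rw [Finset.not_nonempty_iff_eq_empty, Finset.filter_eq_empty_iff] at hemp
      apply hne
      apply coeff_injective x
      rw [map_zero]
      ext i
      exact not_not.1 (hemp (Finset.mem_univ i))
    -- For a generator `i` of maximal position in the support of `c`, coefficient `i` of `φ c`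
    -- receives nothing from the other generators: only those strictly above `x i` could contribute.
    obtain ⟨i, hi⟩ := Finset.exists_maximalFor x _ hex
    have hi1 := (Finset.mem_filter.1 hi.1).2
    have hci := coeff_app φ c i
    rw [hc, map_zero, Pi.zero_apply, Finset.sum_eq_single i, hr i i (lt_irrefl _),
      Pi.single_eq_same, mul_one] at hci
    · exact hi1 hci.symm
    · intro k _ hk
      by_cases hck : coeff x c k = 0
      · rw [hck, zero_mul]
      · rw [hr i k, Pi.single_eq_of_ne hk.symm, mul_zero]
        intro hlt
        exact hlt.not_ge (hi.2 (Finset.mem_filter.2 ⟨Finset.mem_univ k, hck⟩) hlt.le)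
    · simp
  have : ∀ j, IsIso (φ.app j) := fun j =>
    FGModuleCat.isIso_of_bijective _ ⟨hinj j, LinearMap.surjective_of_injective (hinj j)⟩
  exact NatIso.isIso_of_isIso_app φ

/-- A functor that is covered by a free functor has a radical cover: take one with the smallest
number of generators. -/
theorem exists_isRadical {m : ℕ} {y : Fin m → J} (q : freeOn K y ⟶ M) [Epi q] :
    ∃ (n : ℕ) (x : Fin n → J) (p : freeOn K x ⟶ M), Epi p ∧ IsRadical p := by
  classical
  have hex : ∃ n, ∃ (x : Fin n → J) (p : freeOn K x ⟶ M), Epi p := ⟨m, y, q, inferInstance⟩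
  obtain ⟨x, p, hp⟩ := Nat.find_spec hex
  have hmin := fun k => Nat.find_min hex (m := k)
  generalize Nat.find hex = n at x p hmin
  refine ⟨n, x, p, hp, fun i c hc => ?_⟩
  by_contra hne
  obtain _ | n := n
  · exact i.elim0
  refine hmin n n.lt_succ_self ⟨x ∘ i.succAbove, lift _ fun k => (p.app _).hom.hom
    (gen x (i.succAbove k)), ?_⟩
  -- The relation `p c = 0` is solved for the `i`-th generator. Substituting `r` for it factors `p`
  -- through the free functor on the other generators, contradicting the minimal number.
  let r : (freeOn K (x ∘ i.succAbove)).obj (x i) :=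
    mk _ (fun k => -(coeff x c i)⁻¹ * coeff x c (i.succAbove k)) fun k hk => by
      rw [coeff_eq_zero x c hk, mul_zero]
  let t : freeOn K x ⟶ freeOn K (x ∘ i.succAbove) :=
    lift x (i.insertNth (α := fun k => (freeOn K (x ∘ i.succAbove)).obj (x k)) r
      fun k => gen (x ∘ i.succAbove) k)
  refine epi_of_epi_fac (f := t) (h := p) (hom_ext x fun k => ?_)
  change ((lift _ _).app (x k)).hom.hom ((t.app (x k)).hom.hom (gen x k)) = _
  rw [lift_gen]
  induction k using i.succAboveCases with
  | x =>
    rw [Fin.insertNth_apply_same, lift_apply]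
    rw [app_apply, Fin.sum_univ_succAbove _ i, transport_of_le _ le_rfl, map_hom_refl] at hc
    simp only [r, coeff_mk, mul_smul, ← Finset.smul_sum]
    refine (congrArg (-(coeff x c i)⁻¹ • ·) (eq_neg_of_add_eq_zero_right hc)).trans ?_
    rw [neg_smul, smul_neg, neg_neg, smul_smul, inv_mul_cancel₀ hne, one_smul]
  | p k =>
    rw [Fin.insertNth_apply_succAbove]
    exact lift_gen _ _ k

/-- The generators of a retract of a functor generated on `A` lie in `A`. -/
theorem mem_of_retract {P : J ⥤ FGModuleCat.{v} K} {A : Set J}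
    (hA : ∀ j, (⊤ : Submodule K (P.obj j)) ≤
      ⨆ a : {a : A // (a : J) ≤ j}, LinearMap.range (P.map (homOfLE a.2)).hom.hom)
    {n : ℕ} {x : Fin n → J} (s : freeOn K x ⟶ P) (r : P ⟶ freeOn K x) (h : s ≫ r = 𝟙 _)
    (i : Fin n) : x i ∈ A := by
  by_contra hi
  -- The coefficient at generator `i` vanishes on everything transported from an `a ∈ A` with `a ≤ x
  -- i`: as `x i ∉ A`, such an `a` is strictly below `x i`. So it would vanish on the generator
  -- itself.
  have key : (⊤ : Submodule K (P.obj (x i))) ≤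
      LinearMap.ker (LinearMap.proj i ∘ₗ coeff x ∘ₗ (r.app (x i)).hom.hom) := by
    refine (hA _).trans (iSup_le fun a => ?_)
    rintro _ ⟨z, rfl⟩
    change coeff x ((r.app (x i)).hom.hom ((P.map (homOfLE a.2)).hom.hom z)) i = 0
    rw [app_hom_map_hom, coeff_map]
    refine coeff_eq_zero x _ fun hle => hi ?_
    rw [le_antisymm hle a.2]
    exact a.1.2
  have h1 := key (Submodule.mem_top (x := (s.app (x i)).hom.hom (gen x i)))
  have h2 : (r.app (x i)).hom.hom ((s.app (x i)).hom.hom (gen x i)) = gen x i :=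
    FGModuleCat.hom_apply_eq (congrArg (·.app (x i)) h) _
  rw [LinearMap.mem_ker, LinearMap.comp_apply, LinearMap.comp_apply, h2, coeff_gen] at h1
  simp at h1

theorem top_le_iSup_range {n : ℕ} (x : Fin n → J) {A : Set J} (hx : ∀ i, x i ∈ A) (j : J) :
    (⊤ : Submodule K ((freeOn K x).obj j)) ≤
      ⨆ a : {a : A // (a : J) ≤ j},
        LinearMap.range ((freeOn K x).map (homOfLE a.2)).hom.hom := by
  intro c _
  rw [eq_sum x c]
  refine Submodule.sum_mem _ fun i _ => Submodule.smul_mem _ _ ?_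
  by_cases h : x i ≤ j
  · rw [transport_of_le _ h]
    exact Submodule.mem_iSup_of_mem ⟨⟨x i, hx i⟩, h⟩ ⟨_, rfl⟩
  · rw [transport_of_not_le _ h]
    exact Submodule.zero_mem _

/-- A functor on which finitely many elements generate is covered by a free functor. -/
theorem exists_epi_of_generated {A : Set J} (hf : A.Finite)
    (hA : ∀ j, (⊤ : Submodule K (M.obj j)) ≤
      ⨆ a : {a : A // (a : J) ≤ j}, LinearMap.range (M.map (homOfLE a.2)).hom.hom) :
    ∃ (n : ℕ) (x : Fin n → J) (p : freeOn K x ⟶ M), (∀ i, x i ∈ A) ∧ Epi p := by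
  have := hf.to_subtype
  let b := fun a : A => Module.finBasis K (M.obj a)
  obtain ⟨n, ⟨e⟩⟩ := Finite.exists_equiv_fin (Σ a : A, Fin (Module.finrank K (M.obj a)))
  let p := lift (K := K) (M := M) (fun i => ((e.symm i).1 : J)) fun i => b (e.symm i).1 (e.symm i).2
  refine ⟨n, _, p, fun i => (e.symm i).1.2, (functor_epi_iff_surjective p).2 fun j => ?_⟩
  rw [← LinearMap.range_eq_top, eq_top_iff]
  refine (hA j).trans (iSup_le fun ⟨a, haj⟩ => ?_)
  rintro _ ⟨z, rfl⟩
  rw [← (b a).sum_repr z, map_sum]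
  refine Submodule.sum_mem _ fun k _ => ?_
  rw [map_smul]
  refine Submodule.smul_mem _ _ ?_
  obtain ⟨i, hi⟩ := e.symm.surjective ⟨a, k⟩
  have hle : ((e.symm i).1 : J) ≤ j := by rw [hi]; exact haj
  refine ⟨((freeOn K _).map (homOfLE hle)).hom.hom (gen _ i), ?_⟩
  rw [app_hom_map_hom, lift_gen]
  clear_value p
  generalize e.symm i = z at hi hle
  subst hi
  rfl

/-- A right minimal cover by a functor isomorphic to a free functor is a radical cover. -/
theorem exists_iso_isRadical {P : J ⥤ FGModuleCat.{v} K} {m : ℕ} {y : Fin m → J}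
    (e : P ≅ freeOn K y) (p : P ⟶ M) [Epi p] (hp : RightMinimal p) :
    ∃ (n : ℕ) (x : Fin n → J) (e : P ≅ freeOn K x), IsRadical (e.inv ≫ p) := by
  obtain ⟨n, x, q, hq, hr⟩ := exists_isRadical (e.inv ≫ p)
  have : Projective P := Projective.of_iso e.symm inferInstance
  -- Both covers are right minimal with projective sources, so they factor through each other.
  obtain ⟨e', he'⟩ := hp.exists_iso hr.rightMinimal (Projective.factorThru p q)
    (Projective.factorThru_comp _ _) (Projective.factorThru q p) (Projective.factorThru_comp _ _)
  refine ⟨n, x, e', ?_⟩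
  rwa [← he', Iso.inv_hom_id_assoc]

end freeOn

/-- The morphism of `FGModuleCat` given by a linear map. -/
def FGModuleCat.homMk {K : Type v} [Field K] {V W : FGModuleCat.{v} K} (f : V →ₗ[K] W) : V ⟶ W :=
  ObjectProperty.homMk (ModuleCat.ofHom f)

/-! ## Betti diagrams of free functors -/

namespace freeOn

variable {K : Type v} [Field K] {J : Type u} [PartialOrder J]

open Classical in
/-- The inclusion of the span of the generators that sit at `a`. -/
def fiberι {n : ℕ} (x : Fin n → J) (a : J) :
    ({i : Fin n // x i = a} → K) →ₗ[K] (freeOn K x).obj a where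
  toFun w := mk x (fun i => if h : x i = a then w ⟨i, h⟩ else 0) fun _ hi =>
    dif_neg fun h => hi h.le
  map_add' w w' := by
    apply coeff_injective x
    rw [map_add]
    ext i
    by_cases h : x i = a <;> simp [h]
  map_smul' r w := by
    apply coeff_injective x
    rw [map_smul]
    ext i
    by_cases h : x i = a <;> simp [h]

open Classical in
theorem coeff_fiberι {n : ℕ} (x : Fin n → J) (a : J) (w : {i : Fin n // x i = a} → K) (k : Fin n) :
    coeff x (fiberι x a w) k = if h : x k = a then w ⟨k, h⟩ else 0 := rfl

theorem fiberι_single {n : ℕ} (x : Fin n → J) (i : Fin n) [DecidableEq {k : Fin n // x k = x i}] :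
    fiberι (K := K) x (x i) (Pi.single ⟨i, rfl⟩ 1) = gen x i := by
  apply coeff_injective x
  ext k
  rw [coeff_gen, coeff_fiberι]
  by_cases hk : k = i
  · subst hk
    simp
  · rw [Pi.single_eq_of_ne hk]
    split_ifs with h
    · exact Pi.single_eq_of_ne (fun h' => hk (congrArg Subtype.val h')) _
    · rfl

/-- The unit of the Kan extension. -/
def unit {n : ℕ} (x : Fin n → J) (V : J → FGModuleCat.{v} K)
    (θ : ∀ a, V a ≃ₗ[K] ({i : Fin n // x i = a} → K)) :
    Discrete.functor V ⟶ Discrete.functor (id : J → J) ⋙ freeOn K x :=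
  Discrete.natTrans fun a => FGModuleCat.homMk (V := V a.as) (W := (freeOn K x).obj a.as)
    (fiberι x a.as ∘ₗ (θ a.as).toLinearMap)

theorem unit_app_symm {n : ℕ} (x : Fin n → J) (V : J → FGModuleCat.{v} K)
    (θ : ∀ a, V a ≃ₗ[K] ({i : Fin n // x i = a} → K)) (a : J) (w : {i : Fin n // x i = a} → K) :
    ((unit x V θ).app ⟨a⟩).hom.hom ((θ a).symm w) = fiberι x a w := by
  exact congrArg (fiberι x a) (LinearEquiv.apply_symm_apply (θ a) w)

/-- A transformation out of the family `V` is given by arbitrary images of basis vectors; through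
`θ` these are the images of the generators, which determine a map out of `freeOn`. -/
theorem isLeftKanExtension_unit {n : ℕ} (x : Fin n → J) (V : J → FGModuleCat.{v} K)
    (θ : ∀ a, V a ≃ₗ[K] ({i : Fin n // x i = a} → K)) :
    (freeOn K x).IsLeftKanExtension (unit x V θ) := by
  classical
  refine ⟨⟨IsInitial.ofUniqueHom (fun Y => StructuredArrow.homMk (lift x fun i =>
    (Y.hom.app ⟨x i⟩).hom.hom ((θ (x i)).symm (Pi.single ⟨i, rfl⟩ 1))) ?_) ?_⟩⟩
  · ext ⟨a⟩ : 2
    apply FGModuleCat.hom_ext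
    refine LinearMap.ext fun z => ?_
    obtain ⟨w, rfl⟩ := (θ a).symm.surjective z
    change ((lift x _).app a).hom.hom (((unit x V θ).app ⟨a⟩).hom.hom ((θ a).symm w)) = _
    rw [unit_app_symm]
    refine LinearMap.congr_fun (f := ((lift x _).app a).hom.hom ∘ₗ fiberι x a)
      (g := (Y.hom.app ⟨a⟩).hom.hom ∘ₗ (θ a).symm.toLinearMap) ?_ w
    refine LinearMap.pi_ext' fun ⟨i, hi⟩ => LinearMap.ext_ring ?_
    subst hi
    change ((lift x _).app (x i)).hom.hom (fiberι x (x i) (Pi.single ⟨i, rfl⟩ 1)) = _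
    rw [fiberι_single, lift_gen]
    rfl
  · intro Y m
    apply StructuredArrow.hom_ext
    apply hom_ext x
    intro i
    have h := FGModuleCat.hom_apply_eq (congrArg (fun t => t.app ⟨x i⟩) (StructuredArrow.w m))
      ((θ (x i)).symm (Pi.single ⟨i, rfl⟩ 1))
    change _ = ((lift x _).app (x i)).hom.hom (gen x i)
    rw [lift_gen, ← h, ← fiberι_single, ← unit_app_symm x V θ]
    rfl

theorem isFree {n : ℕ} (x : Fin n → J) : IsFree (freeOn K x) := by
  refine ⟨fun a => FGModuleCat.of K ({i : Fin n // x i = a} → K), ?_, _,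
    isLeftKanExtension_unit x _ fun a => LinearEquiv.refl K _⟩
  refine (Set.finite_range x).subset fun a ha => ?_
  by_contra h
  refine ha ((FGModuleCat.isZero_iff_subsingleton _).2 ?_)
  have : IsEmpty {i : Fin n // x i = a} := ⟨fun i => h ⟨i.1, i.2⟩⟩
  change Subsingleton ({i : Fin n // x i = a} → K)
  infer_instance

end freeOn

section

variable {K : Type v} [Field K] {J : Type u} [PartialOrder J]

/-- A family of finite support is encoded by a list of positions in which `a` occurs `dim V a`
times. This replaces abstract free functors by the concrete `freeOn`. -/
theorem exists_fiber_card_eq {L : Type u} (V : L → FGModuleCat.{v} K)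
    (hV : (famSupport V).Finite) :
    ∃ (n : ℕ) (x : Fin n → L), ∀ a, Module.finrank K (V a) = Nat.card {i : Fin n // x i = a} := by
  have := hV.to_subtype
  obtain ⟨n, ⟨e⟩⟩ :=
    Finite.exists_equiv_fin (Σ a : famSupport V, Fin (Module.finrank K (V a)))
  refine ⟨n, fun i => (e.symm i).1, fun a => ?_⟩
  by_cases ha : a ∈ famSupport V
  · rw [← Nat.card_fin (Module.finrank K (V a))]
    refine (Nat.card_congr ((e.symm.subtypeEquiv fun i => ?_).trans
      (Equiv.sigmaSubtype (⟨a, ha⟩ : famSupport V)))).symm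
    exact (Subtype.ext_iff (a1 := (e.symm i).1) (a2 := ⟨a, ha⟩)).symm
  · have h0 : Subsingleton (V a) :=
      (FGModuleCat.isZero_iff_subsingleton _).1 (not_not.1 ha)
    have : IsEmpty {i : Fin n // ((e.symm i).1 : L) = a} :=
      ⟨fun i => ha (by rw [← i.2]; exact (e.symm i.1).1.2)⟩
    rw [Nat.card_of_isEmpty, Module.finrank_zero_of_subsingleton]

theorem IsFreeOn.exists_iso {P : J ⥤ FGModuleCat.{v} K} {V : J → FGModuleCat.{v} K}
    (h : IsFreeOn P V) : ∃ (n : ℕ) (x : Fin n → J), Nonempty (P ≅ freeOn K x) ∧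
      ∀ a, Module.finrank K (V a) = Nat.card {i : Fin n // x i = a} := by
  classical
  obtain ⟨hV, α, hα⟩ := h
  obtain ⟨n, x, hx⟩ := exists_fiber_card_eq V hV
  have θ : ∀ a, V a ≃ₗ[K] ({i : Fin n // x i = a} → K) := fun a =>
    LinearEquiv.ofFinrankEq _ _ (by
      rw [hx, Module.finrank_fintype_fun_eq_card, Nat.card_eq_fintype_card])
  have := freeOn.isLeftKanExtension_unit x V θ
  exact ⟨n, x, ⟨P.leftKanExtensionUnique α _ (freeOn.unit x V θ)⟩, hx⟩

theorem IsFree.exists_iso {P : J ⥤ FGModuleCat.{v} K} (h : IsFree P) :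
    ∃ (n : ℕ) (x : Fin n → J), Nonempty (P ≅ freeOn K x) := by
  obtain ⟨V, hV⟩ := h
  obtain ⟨n, x, e, -⟩ := hV.exists_iso
  exact ⟨n, x, e⟩

theorem IsFree.projective {P : J ⥤ FGModuleCat.{v} K} (h : IsFree P) : Projective P := by
  obtain ⟨n, x, ⟨e⟩⟩ := h.exists_iso
  exact Projective.of_iso e.symm inferInstance

/-! ## Functors discretised by a map -/

/-- A left Kan extension along `f` is generated on the image of `f`. -/
theorem IsDiscretisedBy.generated {I : Type w} [PartialOrder I] {f : I →o J}
    {F : J ⥤ FGModuleCat.{v} K} (h : IsDiscretisedBy f F) (j : J) :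
    (⊤ : Submodule K (F.obj j)) ≤
      ⨆ i : {i : I // f i ≤ j}, LinearMap.range (F.map (homOfLE i.2)).hom.hom := by
  obtain ⟨G, α, hα⟩ := h
  let S : ∀ j, Submodule K (F.obj j) := fun j =>
    ⨆ i : {i : I // f i ≤ j}, LinearMap.range (F.map (homOfLE i.2)).hom.hom
  have hS : ∀ {j k : J} (h : j ⟶ k), S j ≤ (S k).comap (F.map h).hom.hom := by
    intro j k h
    refine iSup_le fun i => ?_
    rintro _ ⟨z, rfl⟩
    refine Submodule.mem_iSup_of_mem ⟨i.1, i.2.trans (leOfHom h)⟩ ⟨z, ?_⟩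
    exact (map_hom_map_hom F _ _ _ z).symm
  let F' : J ⥤ FGModuleCat.{v} K :=
    { obj := fun j => FGModuleCat.of K (S j)
      map := fun h => FGModuleCat.ofHom ((F.map h).hom.hom.restrict (hS h))
      map_id := fun j => by
        apply FGModuleCat.hom_ext
        ext z
        exact map_hom_refl F (𝟙 j) z.1
      map_comp := fun h h' => by
        apply FGModuleCat.hom_ext
        ext z
        exact (map_hom_map_hom F h h' (h ≫ h') z.1).symm }
  let ι : F' ⟶ F :=
    { app := fun j => FGModuleCat.ofHom (V := S j) (W := F.obj j) (S j).subtype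
      naturality := fun _ _ _ => rfl }
  let β : G ⟶ f.monotone.functor ⋙ F' :=
    { app := fun i => FGModuleCat.homMk (V := G.obj i) (W := FGModuleCat.of K (S (f i)))
        (LinearMap.codRestrict (M₂ := F.obj (f i)) (S (f i)) (α.app i).hom.hom fun z =>
          Submodule.mem_iSup_of_mem ⟨i, le_rfl⟩ ⟨_, map_hom_refl F _ _⟩)
      naturality := fun i i' h => by
        apply FGModuleCat.hom_ext
        ext z
        exact Subtype.ext (FGModuleCat.hom_apply_eq (α.naturality h) z) }
  have hβ : β ≫ Functor.whiskerLeft f.monotone.functor ι = α := rfl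
  -- The unit `α` factors through the subfunctor `F'` generated on the image of `f`, so the
  -- universal property gives a section of `ι` and `F'` is all of `F`.
  have hid : F.descOfIsLeftKanExtension α F' β ≫ ι = 𝟙 F := by
    apply F.hom_ext_of_isLeftKanExtension α
    rw [Functor.whiskerLeft_comp, ← Category.assoc, F.descOfIsLeftKanExtension_fac, hβ]
    rfl
  intro z _
  have hz : (ι.app j).hom.hom (((F.descOfIsLeftKanExtension α F' β).app j).hom.hom z) = z :=
    FGModuleCat.hom_apply_eq (congrArg (·.app j) hid) z
  rw [← hz]
  exact Subtype.property (p := fun z => z ∈ S j)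
    (((F.descOfIsLeftKanExtension α F' β).app j).hom.hom z)

theorem IsDiscretisedBy.generated_range {I : Type w} [PartialOrder I] {f : I →o J}
    {F : J ⥤ FGModuleCat.{v} K} (h : IsDiscretisedBy f F) {A : Set J} (hA : Set.range f ⊆ A)
    (j : J) : (⊤ : Submodule K (F.obj j)) ≤
      ⨆ a : {a : A // (a : J) ≤ j}, LinearMap.range (F.map (homOfLE a.2)).hom.hom :=
  (h.generated j).trans (iSup_le fun i =>
    le_iSup (fun a : {a : A // (a : J) ≤ j} => LinearMap.range (F.map (homOfLE a.2)).hom.hom)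
      ⟨⟨f i.1, hA ⟨i.1, rfl⟩⟩, i.2⟩)

theorem CategoryTheory.ShortComplex.Exact.epi_comp {C : Type*} [Category C] [Abelian C]
    {W X Y Z : C} {f : X ⟶ Y} {g : Y ⟶ Z} {w : f ≫ g = 0} (h : (ShortComplex.mk f g w).Exact)
    (q : W ⟶ X) [Epi q] : (ShortComplex.mk (q ≫ f) g (by rw [Category.assoc, w, comp_zero])).Exact := by
  let φ : ShortComplex.mk (q ≫ f) g (by rw [Category.assoc, w, comp_zero]) ⟶
      ShortComplex.mk f g w := { τ₁ := q, τ₂ := 𝟙 _, τ₃ := 𝟙 _ }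
  have : Epi φ.τ₁ := inferInstanceAs (Epi q)
  have : IsIso φ.τ₂ := inferInstanceAs (IsIso (𝟙 Y))
  have : Mono φ.τ₃ := inferInstanceAs (Mono (𝟙 Z))
  exact (ShortComplex.exact_iff_of_epi_of_isIso_of_mono φ).2 h

theorem CategoryTheory.ShortComplex.Exact.comp_mono {C : Type*} [Category C] [Abelian C]
    {W X Y Z : C} {f : X ⟶ Y} {g : Y ⟶ Z} {w : f ≫ g = 0} (h : (ShortComplex.mk f g w).Exact)
    (i : Z ⟶ W) [Mono i] :
    (ShortComplex.mk f (g ≫ i) (by rw [← Category.assoc, w, zero_comp])).Exact := by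
  let φ : ShortComplex.mk f g w ⟶
      ShortComplex.mk f (g ≫ i) (by rw [← Category.assoc, w, zero_comp]) :=
    { τ₁ := 𝟙 _, τ₂ := 𝟙 _, τ₃ := i }
  have : Epi φ.τ₁ := inferInstanceAs (Epi (𝟙 X))
  have : IsIso φ.τ₂ := inferInstanceAs (IsIso (𝟙 Y))
  have : Mono φ.τ₃ := inferInstanceAs (Mono i)
  exact (ShortComplex.exact_iff_of_epi_of_isIso_of_mono φ).1 h

/-! ## Syzygies and minimality of resolutions -/

/-- Continue a sequence that satisfies a relation up to some index. -/
theorem exists_seq_extending {E : ℕ → Type*} (R : ∀ k, E k → E (k + 1) → Prop)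
    (G : ∀ k, E k → Prop) (e : ∀ k, E k) (i : ℕ)
    (hR : ∀ k < i, R k (e k) (e (k + 1))) (hG : G i (e i))
    (hstep : ∀ k x, G k x → ∃ y, R k x y ∧ G (k + 1) y) :
    ∃ s : ∀ k, E k, (∀ k ≤ i, s k = e k) ∧ ∀ k, R k (s k) (s (k + 1)) := by
  classical
  choose next hnext hnextG using hstep
  -- The last `else` is never reached: `G` holds along `s` from index `i` on, by `hGs`.
  let s : ∀ k, E k := fun k => Nat.rec (e 0) (fun k x =>
    if k + 1 ≤ i then e (k + 1) else if h : G k x then next k x h else e (k + 1)) k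
  have hs : ∀ k, s (k + 1) =
    if k + 1 ≤ i then e (k + 1) else if h : G k (s k) then next k (s k) h else e (k + 1) :=
    fun _ => rfl
  have hle : ∀ k ≤ i, s k = e k := by
    rintro (_ | k) hk
    · rfl
    · rw [hs, if_pos hk]
  have hGs : ∀ k, i ≤ k → G k (s k) := by
    intro k hk
    induction k, hk using Nat.le_induction with
    | base => rw [hle i le_rfl]; exact hG
    | succ k hk ih =>
      rw [hs, if_neg (by omega), dif_pos ih]
      exact hnextG _ _ _
  refine ⟨s, hle, fun k => ?_⟩
  by_cases hk : k + 1 ≤ i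
  · rw [hle k (by omega), hle (k + 1) hk]
    exact hR k hk
  · rw [hs, if_neg hk, dif_pos (hGs k (by omega))]
    exact hnext _ _ _

namespace Resolution

variable {K : Type v} [Field K] {J : Type u} [PartialOrder J] {F : J ⥤ FGModuleCat.{v} K}
  {n : ℕ∞} (P : Resolution F n)

/-- The terms of the augmented complex. -/
def obj : ℕ → (J ⥤ FGModuleCat.{v} K)
  | 0 => F
  | k + 1 => P.complex.X k

/-- The differentials of the augmented complex. -/
def dd : ∀ k, P.obj (k + 1) ⟶ P.obj k
  | 0 => P.aug
  | k + 1 => P.complex.d (k + 1) k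

theorem dd_dd (k : ℕ) : P.dd (k + 1) ≫ P.dd k = 0 := by
  cases k with
  | zero => exact P.d_aug
  | succ k => exact P.complex.d_comp_d _ _ _

theorem exact_dd (k : ℕ) (hk : ((k + 1 : ℕ) : ℕ∞) < n) :
    (ShortComplex.mk (P.dd (k + 1)) (P.dd k) (P.dd_dd k)).Exact := by
  cases k with
  | zero => exact P.exact_zero (by simpa using hk)
  | succ k =>
    have h := P.exact_succ k hk
    rwa [HomologicalComplex.exactAt_iff' _ (k + 2) (k + 1) k (by simp) (by simp)] at h

theorem projective_obj (k : ℕ) (hk : (k : ℕ∞) < n) : Projective (P.obj (k + 1)) :=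
  (P.free k hk).projective

theorem isZero_obj (k : ℕ) (hk : n ≤ (k : ℕ∞)) : IsZero (P.obj (k + 1)) :=
  P.isZero k hk

/-- The syzygies. -/
def syz : ℕ → (J ⥤ FGModuleCat.{v} K)
  | 0 => F
  | k + 1 => kernel (P.dd k)

/-- The map of a term to its syzygy. -/
def toSyz : ∀ k, P.obj (k + 1) ⟶ P.syz k
  | 0 => P.aug
  | k + 1 => kernel.lift (P.dd k) (P.dd (k + 1)) (P.dd_dd k)

/-- The inclusion of a syzygy into the term it is a subfunctor of. -/
def syzToObj : ∀ k, P.syz k ⟶ P.obj k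
  | 0 => 𝟙 F
  | k + 1 => kernel.ι (P.dd k)

instance (k : ℕ) : Mono (P.syzToObj k) := by
  cases k
  · exact inferInstanceAs (Mono (𝟙 F))
  · exact inferInstanceAs (Mono (kernel.ι _))

theorem toSyz_syzToObj (k : ℕ) : P.toSyz k ≫ P.syzToObj k = P.dd k := by
  cases k with
  | zero => exact Category.comp_id _
  | succ k => exact kernel.lift_ι _ _ _

theorem syzToObj_toSyz (k : ℕ) : P.syzToObj (k + 1) ≫ P.toSyz k = 0 := by
  rw [← cancel_mono (P.syzToObj k), Category.assoc, toSyz_syzToObj, zero_comp]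
  exact kernel.condition _

theorem epi_toSyz (k : ℕ) (hk : (k : ℕ∞) < n) : Epi (P.toSyz k) := by
  cases k with
  | zero => exact P.epi_aug
  | succ k =>
    exact (P.exact_dd k hk).epi_kernelLift

theorem shortExact_syz (k : ℕ) (hk : (k : ℕ∞) < n) :
    (ShortComplex.mk (P.syzToObj (k + 1)) (P.toSyz k) (P.syzToObj_toSyz k)).ShortExact where
  exact := by
    refine ShortComplex.exact_of_f_is_kernel _ ?_
    exact isKernelOfComp (P.syzToObj k) (P.dd k) (kernelIsKernel (P.dd k))
      (P.syzToObj_toSyz k) (P.toSyz_syzToObj k)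
  mono_f := inferInstance
  epi_g := P.epi_toSyz k hk

variable {P}

/-- An endomorphism of one term over its differential extends to a chain map over `F`: the identity
in lower degrees, lifts by projectivity in higher ones. Minimality makes the chain map an
isomorphism. -/
theorem IsMinimal.rightMinimal_dd (hP : P.IsMinimal) (i : ℕ) : RightMinimal (P.dd i) := by
  intro φ hφ
  let e : ∀ k, P.obj (k + 1) ⟶ P.obj (k + 1) :=
    Function.update (fun k => 𝟙 (P.obj (k + 1))) i φ
  let R : ∀ k, (P.obj (k + 1) ⟶ P.obj (k + 1)) → (P.obj (k + 2) ⟶ P.obj (k + 2)) → Prop :=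
    fun k a b => b ≫ P.dd (k + 1) = P.dd (k + 1) ≫ a
  -- The invariant says that the map is compatible with some map one step below; by exactness this
  -- is what permits the next lift.
  let G : ∀ k, (P.obj (k + 1) ⟶ P.obj (k + 1)) → Prop :=
    fun k a => ∃ χ : P.obj k ⟶ P.obj k, a ≫ P.dd k = P.dd k ≫ χ
  have hei : e i = φ := Function.update_self _ _ _
  have hene : ∀ k, k ≠ i → e k = 𝟙 _ := fun k hk => Function.update_of_ne hk _ _
  have hR : ∀ k < i, R k (e k) (e (k + 1)) := by
    intro k hk
    change e (k + 1) ≫ _ = _ ≫ e k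
    rw [hene k hk.ne]
    obtain rfl | hi := eq_or_ne (k + 1) i
    · rw [hei, hφ, Category.comp_id]
    · rw [hene _ hi, Category.comp_id, Category.id_comp]
  have hG : G i (e i) := ⟨𝟙 _, by rw [hei, hφ, Category.comp_id]⟩
  have hstep : ∀ k x, G k x → ∃ y, R k x y ∧ G (k + 1) y := by
    rintro k a ⟨χ, hχ⟩
    have hex : ∃ b : P.obj (k + 2) ⟶ P.obj (k + 2), b ≫ P.dd (k + 1) = P.dd (k + 1) ≫ a := by
      by_cases hk : ((k + 1 : ℕ) : ℕ∞) < n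
      · have := P.projective_obj (k + 1) hk
        exact ⟨(P.exact_dd k hk).liftFromProjective (P.dd (k + 1) ≫ a)
          (by change (_ ≫ a) ≫ P.dd k = 0
              rw [Category.assoc, hχ, ← Category.assoc, P.dd_dd, zero_comp]),
          (P.exact_dd k hk).liftFromProjective_comp _ _⟩
      · exact ⟨0, (P.isZero_obj (k + 1) (not_lt.1 hk)).eq_of_src _ _⟩
    obtain ⟨b, hb⟩ := hex
    exact ⟨b, hb, a, hb⟩
  obtain ⟨s, hs, hs'⟩ := exists_seq_extending R G e i hR hG hstep
  have h0 : s 0 ≫ P.dd 0 = P.dd 0 := by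
    rw [hs 0 (Nat.zero_le i)]
    obtain rfl | hi := eq_or_ne 0 i
    · rw [hei, hφ]
    · rw [hene _ hi, Category.id_comp]
  let ψ : P.complex ⟶ P.complex :=
    { f := s
      comm' := by
        rintro _ k rfl
        exact hs' k }
  have : IsIso ψ := hP ψ h0
  have h : IsIso (ψ.f i) :=
    inferInstanceAs (IsIso ((HomologicalComplex.eval _ _ i).map ψ))
  change IsIso (s i) at h
  rwa [hs i le_rfl, hei] at h

theorem IsMinimal.rightMinimal_toSyz (hP : P.IsMinimal) (i : ℕ) : RightMinimal (P.toSyz i) :=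
  RightMinimal.of_comp (i := P.syzToObj i) (by
    rw [toSyz_syzToObj]
    exact hP.rightMinimal_dd i)

/-- Going up the complex, the inverse of an isomorphism `s k` lifts to some `ψ` on the next term.
Both composites of `ψ` with `s (k + 1)` lie over the identity, so right minimality makes them
isomorphisms. The lift requires `inv (s k)` to be compatible with `inv (s (k - 1))`; hence the
induction over two consecutive terms. -/
theorem isMinimal_of_rightMinimal_dd (h : ∀ k : ℕ, (k : ℕ∞) < n → RightMinimal (P.dd k)) :
    P.IsMinimal := by
  intro φ hφ
  let s : ∀ k, P.obj k ⟶ P.obj k := fun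
    | 0 => 𝟙 F
    | k + 1 => φ.f k
  have hs : ∀ k, s (k + 1) ≫ P.dd k = P.dd k ≫ s k := by
    rintro (_ | k)
    · exact hφ.trans (Category.comp_id _).symm
    · exact φ.comm _ _
  suffices hiso : ∀ k, IsIso (s k) by
    have : ∀ k, IsIso (φ.f k) := fun k => hiso (k + 1)
    exact HomologicalComplex.Hom.isIso_of_components φ
  suffices hiso : ∀ k, IsIso (s k) ∧ IsIso (s (k + 1)) from fun k => (hiso k).1
  have step : ∀ k, IsIso (s k) →
      (∀ θ : P.obj k ⟶ P.obj k, θ ≫ s k = 𝟙 _ → (k : ℕ∞) < n →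
        ∃ ψ : P.obj (k + 1) ⟶ P.obj (k + 1), ψ ≫ P.dd k = P.dd k ≫ θ) → IsIso (s (k + 1)) := by
    intro k hk hlift
    by_cases hkn : (k : ℕ∞) < n
    · obtain ⟨ψ, hψ⟩ := hlift (inv (s k)) (IsIso.inv_hom_id _) hkn
      have h1 : IsIso (s (k + 1) ≫ ψ) := h k hkn _ (by
        rw [Category.assoc, hψ, ← Category.assoc, hs, Category.assoc, IsIso.hom_inv_id,
          Category.comp_id])
      have h2 : IsIso (ψ ≫ s (k + 1)) := h k hkn _ (by
        rw [Category.assoc, hs, ← Category.assoc, hψ, Category.assoc, IsIso.inv_hom_id,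
          Category.comp_id])
      have : Mono (s (k + 1)) := mono_of_mono (s (k + 1)) ψ
      have : Epi (s (k + 1)) := epi_of_epi ψ (s (k + 1))
      exact isIso_of_mono_of_epi _
    · have hz := P.isZero_obj k (not_lt.1 hkn)
      exact ⟨0, hz.eq_of_src _ _, hz.eq_of_src _ _⟩
  intro k
  induction k with
  | zero =>
    refine ⟨inferInstanceAs (IsIso (𝟙 F)), step 0 (inferInstanceAs (IsIso (𝟙 F))) ?_⟩
    intro θ hθ _
    refine ⟨𝟙 _, ?_⟩
    rw [show θ = 𝟙 _ from (Category.comp_id θ).symm.trans hθ, Category.id_comp, Category.comp_id]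
  | succ k ih =>
    obtain ⟨h1, h2⟩ := ih
    refine ⟨h2, step (k + 1) h2 fun θ hθ hkn => ?_⟩
    have := P.projective_obj (k + 1) hkn
    have hθ' : θ ≫ P.dd k = P.dd k ≫ inv (s k) := by
      rw [IsIso.eq_comp_inv, Category.assoc, ← hs, ← Category.assoc, hθ, Category.id_comp]
    exact ⟨(P.exact_dd k hkn).liftFromProjective (P.dd (k + 1) ≫ θ)
      (by change (_ ≫ θ) ≫ P.dd k = 0
          rw [Category.assoc, hθ', ← Category.assoc, P.dd_dd, zero_comp]),
      (P.exact_dd k hkn).liftFromProjective_comp _ _⟩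

end Resolution

/-! ## Construction of minimal resolutions -/

section

variable {K : Type v} [Field K] {J : Type u} [PartialOrder J] {n : ℕ∞}

/-- A resolution spliced together from right minimal covers. -/
theorem hasMinimalResolution_of_covers (S X : ℕ → (J ⥤ FGModuleCat.{v} K))
    (π : ∀ k, X k ⟶ S k) (ι : ∀ k, S (k + 1) ⟶ X k) (w : ∀ k, ι k ≫ π k = 0) (hn : 1 ≤ n)
    (free : ∀ k : ℕ, (k : ℕ∞) < n → IsFree (X k)) (zero : ∀ k : ℕ, n ≤ (k : ℕ∞) → IsZero (X k))
    (hS : ∀ k : ℕ, (k : ℕ∞) < n → (ShortComplex.mk (ι k) (π k) (w k)).ShortExact)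
    (hπ : ∀ k : ℕ, (k : ℕ∞) < n → RightMinimal (π k)) : HasMinimalResolution (S 0) n := by
  have hlt : ∀ k : ℕ, ((k + 1 : ℕ) : ℕ∞) < n → (k : ℕ∞) < n := fun k hk =>
    lt_trans (by exact_mod_cast k.lt_succ_self) hk
  have h0 : ((0 : ℕ) : ℕ∞) < n := lt_of_lt_of_le (by simp) hn
  have hsq : ∀ k, (π (k + 2) ≫ ι (k + 1)) ≫ π (k + 1) ≫ ι k = 0 := fun k => by
    rw [Category.assoc, ← Category.assoc (ι (k + 1)), w, zero_comp, comp_zero]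
  let C : ChainComplex (J ⥤ FGModuleCat.{v} K) ℕ :=
    ChainComplex.of X (fun k => π (k + 1) ≫ ι k) hsq
  have hd : ∀ k, C.d (k + 1) k = π (k + 1) ≫ ι k := fun k => ChainComplex.of_d X (fun k => π (k + 1) ≫ ι k) k
  let P : Resolution (S 0) n :=
    { complex := C
      aug := π 0
      d_aug := by rw [hd]; exact (Category.assoc _ _ _).trans (by rw [w, comp_zero])
      free := free
      isZero := zero
      epi_aug := (hS 0 h0).epi_g
      exact_zero := fun h1 => by
        have := (hS 1 (by simpa using h1)).epi_g
        have e := (hS 0 h0).exact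
        simp only [hd]
        exact e.epi_comp (π 1)
      exact_succ := fun i hi => by
        have := (hS (i + 2) hi).epi_g
        have := (hS i (hlt _ (hlt _ hi))).mono_f
        have e := (hS (i + 1) (hlt _ hi)).exact
        rw [HomologicalComplex.exactAt_iff' _ (i + 2) (i + 1) i (by simp) (by simp)]
        change (ShortComplex.mk (C.d (i + 2) (i + 1)) (C.d (i + 1) i) _).Exact
        simp only [hd]
        exact (e.epi_comp (π (i + 2))).comp_mono (ι i) }
  refine ⟨P, Resolution.isMinimal_of_rightMinimal_dd fun k hk => ?_⟩
  cases k with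
  | zero => exact hπ 0 hk
  | succ k =>
    have := (hS k (hlt _ hk)).mono_f
    rw [show P.dd (k + 1) = π (k + 1) ≫ ι k from hd k]
    exact (hπ (k + 1) hk).comp_mono (ι k)

/-- A property of `k`-th syzygies that gives rise to resolutions of length `n` by free functors
with generators in `A`. -/
structure IsSyzygyProperty (A : Set J) (n : ℕ∞)
    (X : ℕ → (J ⥤ FGModuleCat.{v} K) → Prop) : Prop where
  cover : ∀ (k : ℕ) (M : J ⥤ FGModuleCat.{v} K), (k : ℕ∞) < n → X k M →
    ∃ (m : ℕ) (y : Fin m → J) (q : freeOn K y ⟶ M), (∀ i, y i ∈ A) ∧ Epi q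
  syzygy : ∀ (k : ℕ) (M N : J ⥤ FGModuleCat.{v} K) (m : ℕ) (x : Fin m → J) (ι : N ⟶ freeOn K x)
    (p : freeOn K x ⟶ M) (w : ι ≫ p = 0), (k : ℕ∞) < n → X k M →
    (ShortComplex.mk ι p w).ShortExact → (∀ i, x i ∈ A) → freeOn.IsRadical p → X (k + 1) N

/-- By right minimality the source of a radical cover is a retract of the source of any free cover.
-/
theorem freeOn.IsRadical.mem {M : J ⥤ FGModuleCat.{v} K} {m n : ℕ} {x : Fin n → J}
    {y : Fin m → J} {A : Set J} (hy : ∀ i, y i ∈ A) {p : freeOn K x ⟶ M} (hp : IsRadical p)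
    [Epi p] (q : freeOn K y ⟶ M) [Epi q] (i : Fin n) : x i ∈ A := by
  have := hp.rightMinimal (Projective.factorThru p q ≫ Projective.factorThru q p) (by simp)
  exact mem_of_retract (top_le_iSup_range y hy) (Projective.factorThru p q)
    (Projective.factorThru q p ≫ inv (Projective.factorThru p q ≫ Projective.factorThru q p))
    (by rw [← Category.assoc, IsIso.hom_inv_id]) i

namespace IsSyzygyProperty

variable {A : Set J} {X : ℕ → (J ⥤ FGModuleCat.{v} K) → Prop}

theorem hasMinimalResolution (hX : IsSyzygyProperty A n X) {F : J ⥤ FGModuleCat.{v} K}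
    (hF : X 0 F) (hn : 1 ≤ n) : HasMinimalResolution F n := by
  -- The step is made total so that it can be chosen and iterated. The initial objects are
  -- irrelevant values where the property fails, but in degrees `≥ n` they supply the zero terms.
  have step : ∀ (k : ℕ) (M : J ⥤ FGModuleCat.{v} K),
      ∃ (N Q : J ⥤ FGModuleCat.{v} K) (π : Q ⟶ M) (ι : N ⟶ Q) (w : ι ≫ π = 0),
        ((k : ℕ∞) < n → X k M → IsFree Q ∧ (ShortComplex.mk ι π w).ShortExact ∧ RightMinimal π ∧
          X (k + 1) N) ∧ (n ≤ k → IsZero Q) := by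
    intro k M
    by_cases hk : (k : ℕ∞) < n
    · by_cases hM : X k M
      · obtain ⟨m, y, q, hy, hq⟩ := hX.cover k M hk hM
        obtain ⟨l, x, p, hp, hr⟩ := freeOn.exists_isRadical q
        have hS : (ShortComplex.mk (kernel.ι p) p (kernel.condition p)).ShortExact :=
          { exact := ShortComplex.exact_kernel p }
        exact ⟨kernel p, freeOn K x, p, kernel.ι p, kernel.condition p, fun _ _ =>
          ⟨freeOn.isFree x, hS, hr.rightMinimal,
            hX.syzygy k M _ l x _ p _ hk hM hS (hr.mem hy q) hr⟩, fun h => absurd hk h.not_gt⟩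
      · exact ⟨⊥_ _, ⊥_ _, 0, 0, zero_comp, fun _ h => absurd h hM, fun h => absurd hk h.not_gt⟩
    · exact ⟨⊥_ _, ⊥_ _, 0, 0, zero_comp, fun h => absurd h hk, fun _ => (initialIsInitial.isZero)⟩
  choose N Q π ι w h1 h2 using step
  let S : ℕ → (J ⥤ FGModuleCat.{v} K) := fun k => Nat.rec F (fun k M => N k M) k
  have hS : ∀ k : ℕ, (k : ℕ∞) ≤ n → X k (S k) := by
    intro k
    induction k with
    | zero => exact fun _ => hF
    | succ k ih =>
      intro hk
      have hlt : (k : ℕ∞) < n := lt_of_lt_of_le (by exact_mod_cast k.lt_succ_self) hk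
      exact (h1 k (S k) hlt (ih hlt.le)).2.2.2
  exact hasMinimalResolution_of_covers S (fun k => Q k (S k)) (fun k => π k (S k))
    (fun k => ι k (S k)) (fun k => w k (S k)) hn (fun k hk => (h1 k _ hk (hS k hk.le)).1)
    (fun k hk => h2 k _ hk) (fun k hk => (h1 k _ hk (hS k hk.le)).2.1)
    (fun k hk => (h1 k _ hk (hS k hk.le)).2.2.1)

/-- The property passes to the kernel of every radical cover, not of a chosen one. Hence it reaches
the syzygies of an arbitrary minimal resolution, whose terms are radical covers by
`exists_iso_isRadical`; its length `n'` need not be `n`. -/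
theorem syz (hX : IsSyzygyProperty A n X) {F : J ⥤ FGModuleCat.{v} K} (hF : X 0 F) {n' : ℕ∞}
    {P : Resolution F n'} (hP : P.IsMinimal) (k : ℕ) (hk : (k : ℕ∞) < n) (hk' : (k : ℕ∞) < n') :
    X k (P.syz k) ∧ ∃ (m : ℕ) (x : Fin m → J) (e : P.obj (k + 1) ≅ freeOn K x),
      (∀ i, x i ∈ A) ∧ freeOn.IsRadical (e.inv ≫ P.toSyz k) := by
  have hcov : ∀ k : ℕ, (k : ℕ∞) < n → (k : ℕ∞) < n' → X k (P.syz k) →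
      ∃ (m : ℕ) (x : Fin m → J) (e : P.obj (k + 1) ≅ freeOn K x),
      (∀ i, x i ∈ A) ∧ freeOn.IsRadical (e.inv ≫ P.toSyz k) := by
    intro k hk hk' h
    have := P.epi_toSyz k hk'
    obtain ⟨m, y, ⟨e⟩⟩ := (P.free k hk').exists_iso
    obtain ⟨l, x, e', he'⟩ := freeOn.exists_iso_isRadical (P := P.obj (k + 1)) e (P.toSyz k)
      (hP.rightMinimal_toSyz k)
    obtain ⟨m, y, q, hy, hq⟩ := hX.cover k _ hk h
    exact ⟨l, x, e', he'.mem hy q, he'⟩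
  suffices h : X k (P.syz k) from ⟨h, hcov k hk hk' h⟩
  induction k with
  | zero => exact hF
  | succ k ih =>
    have hlt : ((k : ℕ) : ℕ∞) < ((k + 1 : ℕ) : ℕ∞) := by exact_mod_cast k.lt_succ_self
    have h := ih (hlt.trans hk) (hlt.trans hk')
    obtain ⟨m, x, e, hx, he⟩ := hcov k (hlt.trans hk) (hlt.trans hk') h
    refine hX.syzygy k _ _ m x (P.syzToObj (k + 1) ≫ e.hom) (e.inv ≫ P.toSyz k)
      (by simp [P.syzToObj_toSyz]) (hlt.trans hk) h ?_ hx he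
    exact ShortComplex.shortExact_of_iso
      (ShortComplex.isoMk (S₁ := ShortComplex.mk _ _ (P.syzToObj_toSyz k))
        (Iso.refl (P.syz (k + 1))) e (Iso.refl (P.syz k)) (Category.id_comp _)
        ((Iso.hom_inv_id_assoc e _).trans (Category.comp_id _).symm))
      (P.shortExact_syz k (hlt.trans hk'))

end IsSyzygyProperty

/-! ## Syzygies of a functor with a given resolution -/

section

variable {K : Type v} [Field K] {J : Type u} [PartialOrder J]

theorem IsDiscretisedBy.exists_epi {I : Type w} [PartialOrder I] [Finite I] {f : I →o J}
    {F : J ⥤ FGModuleCat.{v} K} (h : IsDiscretisedBy f F) :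
    ∃ (m : ℕ) (y : Fin m → J) (q : freeOn K y ⟶ F), (∀ i, y i ∈ Set.range f) ∧ Epi q :=
  freeOn.exists_epi_of_generated (Set.finite_range f) (h.generated_range subset_rfl)

/-- If `F` has a resolution whose terms are generated on `A`, then being a retract of the `k`-th
syzygy in this resolution is inherited by the syzygies in radical covers. -/
theorem Resolution.isSyzygyProperty_retract {F : J ⥤ FGModuleCat.{v} K} {n : ℕ∞}
    (R : Resolution F n) {A : Set J}
    (hR : ∀ k : ℕ, (k : ℕ∞) < n →
      ∃ (m : ℕ) (y : Fin m → J) (q : freeOn K y ⟶ R.complex.X k), (∀ i, y i ∈ A) ∧ Epi q) :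
    IsSyzygyProperty A n fun k M => Nonempty (Retract M (R.syz k)) where
  cover := by
    rintro k M hk ⟨h⟩
    obtain ⟨m, y, q, hy, hq⟩ := hR k hk
    have := R.epi_toSyz k hk
    have hq : Epi (X := freeOn K y) (Y := R.obj (k + 1)) q := hq
    exact ⟨m, y, (show freeOn K y ⟶ R.obj (k + 1) from q) ≫ R.toSyz k ≫ h.r, hy, inferInstance⟩
  syzygy := by
    rintro k M N m x ι p w hk ⟨h⟩ hS - hp
    have := R.epi_toSyz k hk
    have hepi : Epi p := hS.epi_g
    have := R.projective_obj k hk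
    have hιm : Mono ι := hS.mono_f
    -- `u` and `v` lift the inclusion and the retraction to the covers. Their composite lies over
    -- the identity of `M`, so it is invertible; after correcting `v` by this inverse, they restrict
    -- to a retraction on the kernels.
    let u := Projective.factorThru (p ≫ h.i) (R.toSyz k)
    have hu : u ≫ R.toSyz k = p ≫ h.i := Projective.factorThru_comp _ _
    let v := Projective.factorThru (R.toSyz k ≫ h.r) p
    have hv : v ≫ p = R.toSyz k ≫ h.r := Projective.factorThru_comp _ _
    have huv : (u ≫ v) ≫ p = p := by
      rw [Category.assoc, hv, ← Category.assoc, hu, Category.assoc, h.retract, Category.comp_id]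
    have := hp.rightMinimal _ huv
    have huv' : inv (u ≫ v) ≫ p = p := by rw [IsIso.inv_comp_eq, huv]
    have hu0 : (ι ≫ u) ≫ R.toSyz k = 0 := by
      rw [Category.assoc, hu, ← Category.assoc, w, zero_comp]
    have hv0 : (R.syzToObj (k + 1) ≫ v ≫ inv (u ≫ v)) ≫ p = 0 := by
      rw [Category.assoc, Category.assoc, huv', hv, ← Category.assoc, R.syzToObj_toSyz, zero_comp]
    have hRk := R.shortExact_syz k hk
    have := hRk.mono_f
    refine ⟨⟨hRk.exact.lift (ι ≫ u) hu0, hS.exact.lift _ hv0, ?_⟩⟩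
    rw [← cancel_mono ι, Category.assoc]
    have h1 : hS.exact.lift _ hv0 ≫ ι = _ := hS.exact.lift_f _ _
    have h2 : hRk.exact.lift (ι ≫ u) hu0 ≫ R.syzToObj (k + 1) = _ := hRk.exact.lift_f _ _
    rw [h1, ← Category.assoc, h2, Category.assoc, ← Category.assoc u, IsIso.hom_inv_id,
      Category.comp_id, Category.id_comp]

/-! ## Functors that are constant below a set -/

/-- `M` is determined by its values on `A`: the value at `j` is the value at the greatest element
of `A` below `j`, and it is zero if there is no element of `A` below `j`. -/
structure IsDeterminedOn (A : Set J) (M : J ⥤ FGModuleCat.{v} K) : Prop where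
  bijective : ∀ {r j : J} (hr : IsGreatest {a | a ∈ A ∧ a ≤ j} r),
    Function.Bijective (M.map (homOfLE hr.1.2)).hom.hom
  eq_zero : ∀ {j : J}, (∀ a ∈ A, ¬ a ≤ j) → ∀ z : M.obj j, z = 0

/-- Below each element that is above some element of `A` there is a greatest element of `A`. -/
def HasGreatestBelow (A : Set J) : Prop :=
  ∀ j, (∃ a ∈ A, a ≤ j) → ∃ r, IsGreatest {a | a ∈ A ∧ a ≤ j} r

theorem IsDeterminedOn.generated {A : Set J} (hA : HasGreatestBelow A)
    {M : J ⥤ FGModuleCat.{v} K} (hM : IsDeterminedOn A M) (j : J) :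
    (⊤ : Submodule K (M.obj j)) ≤
      ⨆ a : {a : A // (a : J) ≤ j}, LinearMap.range (M.map (homOfLE a.2)).hom.hom := by
  intro z _
  by_cases h : ∃ a ∈ A, a ≤ j
  · obtain ⟨r, hr⟩ := hA j h
    obtain ⟨y, rfl⟩ := (hM.bijective hr).2 z
    exact Submodule.mem_iSup_of_mem ⟨⟨r, hr.1.1⟩, hr.1.2⟩ ⟨y, rfl⟩
  · push Not at h
    rw [hM.eq_zero h z]
    exact Submodule.zero_mem _

theorem isDeterminedOn_freeOn {A : Set J} {m : ℕ} {x : Fin m → J} (hx : ∀ i, x i ∈ A) :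
    IsDeterminedOn A (freeOn K x) where
  bijective {r j} hr := by
    refine ⟨fun y z h => ?_, fun z => ⟨freeOn.mk x (freeOn.coeff x z) fun i hi => ?_, ?_⟩⟩
    · exact freeOn.coeff_injective x (congrArg (freeOn.coeff x (j := j)) h)
    · exact freeOn.coeff_eq_zero x z fun h => hi (hr.2 ⟨hx i, h⟩)
    · exact freeOn.coeff_injective x rfl
  eq_zero {j} hj z := by
    apply freeOn.coeff_injective x
    ext i
    exact freeOn.coeff_eq_zero x z (hj _ (hx i))

/-- This is the five lemma for the maps from the values at `r` to those at `j`. -/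
theorem IsDeterminedOn.of_shortExact {A : Set J}
    {S : ShortComplex (J ⥤ FGModuleCat.{v} K)} (hS : S.ShortExact) (h₂ : IsDeterminedOn A S.X₂)
    (h₃ : IsDeterminedOn A S.X₃) : IsDeterminedOn A S.X₁ := by
  have hf := (functor_mono_iff_injective S.f).1 hS.mono_f
  have he := functor_exact_app hS.exact
  constructor
  · intro r j hr
    refine ⟨fun y z h => hf r ((h₂.bijective hr).1 ?_), fun z => ?_⟩
    · rw [← app_hom_map_hom, ← app_hom_map_hom, h]
    · obtain ⟨y, hy⟩ := (h₂.bijective hr).2 ((S.f.app j).hom.hom z)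
      have hy0 : (S.g.app r).hom.hom y = 0 := by
        refine (h₃.bijective hr).1 ?_
        rw [← app_hom_map_hom, hy, map_zero]
        exact (he j).apply_apply_eq_zero z
      obtain ⟨z', rfl⟩ := (he r y).1 hy0
      refine ⟨z', hf j ?_⟩
      rw [app_hom_map_hom, hy]
  · intro j hj z
    refine hf j ?_
    rw [h₂.eq_zero hj ((S.f.app j).hom.hom z), map_zero]

theorem isSyzygyProperty_isDeterminedOn {A : Set J} (hA : HasGreatestBelow A) (hf : A.Finite) :
    IsSyzygyProperty A ⊤ fun _ M => IsDeterminedOn (K := K) A M where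
  cover _ _ _ hM := freeOn.exists_epi_of_generated hf (hM.generated hA)
  syzygy _ _ _ _ _ _ _ _ _ hM hS hx _ :=
    IsDeterminedOn.of_shortExact hS (isDeterminedOn_freeOn hx) hM

/-! ### Cofree functors, the test objects for injectivity -/

namespace Cofree

open Classical in
/-- The subspace that is divided out at `k`. -/
def sub (j : J) (W : FGModuleCat.{v} K) (k : J) : Submodule K W := if k ≤ j then ⊥ else ⊤

theorem sub_of_le {j : J} (W : FGModuleCat.{v} K) {k : J} (h : k ≤ j) : sub j W k = ⊥ := if_pos h

theorem sub_of_not_le {j : J} (W : FGModuleCat.{v} K) {k : J} (h : ¬ k ≤ j) : sub j W k = ⊤ :=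
  if_neg h

theorem sub_le {j j' : J} (W : FGModuleCat.{v} K) {k k' : J} (h : j' ≤ j) (h' : k ≤ k') :
    sub j W k ≤ sub j' W k' := by
  by_cases hk : k' ≤ j'
  · rw [sub_of_le W ((h'.trans hk).trans h)]
    exact bot_le
  · rw [sub_of_not_le W hk]
    exact le_top

end Cofree

/-- The functor with the value `W` at the elements `≤ j`, and zero elsewhere. -/
def cofree (j : J) (W : FGModuleCat.{v} K) : J ⥤ FGModuleCat.{v} K where
  obj k := FGModuleCat.of K (W ⧸ Cofree.sub j W k)
  map h := FGModuleCat.ofHom (Submodule.factor (Cofree.sub_le W le_rfl (leOfHom h)))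
  map_id k := by
    apply FGModuleCat.hom_ext
    apply Submodule.linearMap_qext
    rfl
  map_comp h h' := by
    apply FGModuleCat.hom_ext
    apply Submodule.linearMap_qext
    rfl

namespace Cofree

/-- The projection of `W` to the value at `k`. -/
def mk (j : J) (W : FGModuleCat.{v} K) (k : J) : W →ₗ[K] (cofree j W).obj k :=
  Submodule.mkQ (sub j W k)

theorem map_mk (j : J) (W : FGModuleCat.{v} K) {k k' : J} (h : k ⟶ k') (z : W) :
    ((cofree j W).map h).hom.hom (mk j W k z) = mk j W k' z := rfl

theorem mk_injective {j : J} (W : FGModuleCat.{v} K) {k : J} (h : k ≤ j) :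
    Function.Injective (mk j W k) := by
  rw [← LinearMap.ker_eq_bot]
  exact (Submodule.ker_mkQ _).trans (sub_of_le W h)

theorem mk_surjective (j : J) (W : FGModuleCat.{v} K) (k : J) : Function.Surjective (mk j W k) :=
  Submodule.mkQ_surjective _

theorem eq_of_not_le {j : J} (W : FGModuleCat.{v} K) {k : J} (h : ¬ k ≤ j)
    (y z : (cofree j W).obj k) : y = z := by
  have := Submodule.Quotient.subsingleton_iff.2 (sub_of_not_le W h)
  exact Subsingleton.elim (α := W ⧸ sub j W k) y z

/-- The natural transformation defined by maps to `W` that are compatible below `j`. -/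
def lift (j : J) (W : FGModuleCat.{v} K) {L : Type*} [Category L] (H : L ⥤ J)
    (M : L ⥤ FGModuleCat.{v} K) (t : ∀ l, M.obj l →ₗ[K] W)
    (ht : ∀ {l l' : L} (h : l ⟶ l'), H.obj l' ≤ j →
      ∀ z, t l' ((M.map h).hom.hom z) = t l z) : M ⟶ H ⋙ cofree j W where
  app l := FGModuleCat.homMk (W := (cofree j W).obj (H.obj l)) (mk j W _ ∘ₗ t l)
  naturality l l' h := by
    apply FGModuleCat.hom_ext
    ext z
    change mk j W (H.obj l') (t l' ((M.map h).hom.hom z)) = mk j W (H.obj l') (t l z)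
    by_cases hl : H.obj l' ≤ j
    · rw [ht h hl]
    · exact eq_of_not_le W hl _ _

/-- The quotient map for `j' ≤ j`. -/
def proj {j j' : J} (h : j' ≤ j) (W : FGModuleCat.{v} K) : cofree j W ⟶ cofree j' W where
  app k := FGModuleCat.ofHom (Submodule.factor (sub_le W h le_rfl))
  naturality k k' h := by
    apply FGModuleCat.hom_ext
    apply Submodule.linearMap_qext
    rfl

end Cofree

open Classical in
/-- The map `M a ⟶ M j` if `a ≤ j`, and zero otherwise. -/
def transportHom (M : J ⥤ FGModuleCat.{v} K) (a j : J) : M.obj a →ₗ[K] M.obj j :=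
  if h : a ≤ j then (M.map (homOfLE h)).hom.hom else 0

theorem transportHom_of_le (M : J ⥤ FGModuleCat.{v} K) {a j : J} (h : a ≤ j) (z : M.obj a) :
    transportHom M a j z = (M.map (homOfLE h)).hom.hom z := by
  rw [transportHom, dif_pos h]

/-- Surjectivity and vanishing follow from generation on the image of `g`. For injectivity of `F r ⟶
F j`, extend the identity of `F r`: every `g i ≤ j` is already `≤ r`, so `G` maps compatibly to the
functor that is `F r` below `j` and zero elsewhere, and the Kan extension property carries this to
`F`. -/
theorem IsDiscretisedBy.isDeterminedOn {I : Type w} [PartialOrder I] {g : I →o J}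
    {F : J ⥤ FGModuleCat.{v} K} (h : IsDiscretisedBy g F) {A : Set J} (hg : Set.range g ⊆ A) :
    IsDeterminedOn A F := by
  have hgen := h.generated
  constructor
  · intro r j hr
    constructor
    · obtain ⟨G, α, hα⟩ := h
      let W := F.obj r
      have hgr : ∀ i, g i ≤ j → g i ≤ r := fun i hi => hr.2 ⟨hg ⟨i, rfl⟩, hi⟩
      let β : G ⟶ g.monotone.functor ⋙ cofree j W :=
        Cofree.lift j W g.monotone.functor G
          (fun i => transportHom F (g i) r ∘ₗ (α.app i).hom.hom) (by
            intro i i' h hi' z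
            have hle : g i' ≤ r := hgr i' hi'
            have hle' : g i ≤ r := (g.monotone (leOfHom h)).trans hle
            refine (transportHom_of_le F hle _).trans
              (Eq.trans ?_ (transportHom_of_le F hle' _).symm)
            refine (congrArg (F.map (homOfLE hle)).hom.hom
              (FGModuleCat.hom_apply_eq (α.naturality h) z)).trans ?_
            exact map_hom_map_hom F _ _ _ _)
      let φ := F.descOfIsLeftKanExtension α _ β
      let ψ : F ⟶ cofree r W := Cofree.lift r W (𝟭 J) F (fun k => transportHom F k r) (by
        intro k k' h hk' z
        have hle : k' ≤ r := hk'
        rw [transportHom_of_le F hle, transportHom_of_le F ((leOfHom h).trans hle),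
          map_hom_map_hom])
      -- Both maps agree on `G`. Since `ψ` is the identity of `F r` at `r`, so is `φ`; and `φ` at
      -- `r` is detected at `j`, the target being constant between them.
      have hφψ : φ ≫ Cofree.proj hr.1.2 W = ψ := by
        apply F.hom_ext_of_isLeftKanExtension α
        rw [Functor.whiskerLeft_comp, ← Category.assoc, F.descOfIsLeftKanExtension_fac]
        rfl
      rw [injective_iff_map_eq_zero]
      intro z hz
      have h1 : (φ.app r).hom.hom z = 0 := by
        obtain ⟨w, hw⟩ := Cofree.mk_surjective j W r ((φ.app r).hom.hom z)
        have h2 := app_hom_map_hom φ (homOfLE hr.1.2) z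
        rw [hz, map_zero, ← hw, Cofree.map_mk] at h2
        rw [← hw, Cofree.mk_injective W le_rfl (h2.symm.trans (map_zero _).symm), map_zero]
      have h3 : (ψ.app r).hom.hom z = 0 := by
        rw [← hφψ]
        change ((Cofree.proj hr.1.2 W).app r).hom.hom ((φ.app r).hom.hom z) = 0
        rw [h1, map_zero]
      have h4 : transportHom F r r z = 0 :=
        Cofree.mk_injective W (le_refl r) (h3.trans (map_zero _).symm)
      rwa [transportHom_of_le F le_rfl, map_hom_refl] at h4
    · rw [← LinearMap.range_eq_top, eq_top_iff]
      refine (hgen j).trans (iSup_le fun i => ?_)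
      rintro _ ⟨z, rfl⟩
      exact ⟨(F.map (homOfLE (hr.2 ⟨hg ⟨i.1, rfl⟩, i.2⟩))).hom.hom z, map_hom_map_hom F _ _ _ z⟩
  · intro j hj z
    have : IsEmpty {i : I // g i ≤ j} := ⟨fun i => hj _ (hg ⟨i.1, rfl⟩) i.2⟩
    have hz := hgen j (Submodule.mem_top (x := z))
    rwa [iSup_of_empty, Submodule.mem_bot] at hz

/-! ## Functoriality and exactness of the Koszul complex -/

namespace Koszul

section Functoriality

variable {K : Type v} [Field K] {I : Type u} [PartialOrder I] [Finite I]
  {G H H' : I ⥤ FGModuleCat.{v} K}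

/-- The map of colimits induced by a natural transformation. -/
def colimOnMap (φ : G ⟶ H) (A : Set I) : colimOn G A ⟶ colimOn H A :=
  colimDesc G A (fun x => φ.app x ≫ colimι H A x) fun x y h => by
    rw [← Category.assoc, φ.naturality, Category.assoc, map_colimι]

theorem ι_colimOnMap (φ : G ⟶ H) (A : Set I) (x : A) :
    colimι G A x ≫ colimOnMap φ A = φ.app x ≫ colimι H A x :=
  colimι_desc _ _ _ _ _

theorem colimOnMap_comp (φ : G ⟶ H) (ψ : H ⟶ H') (A : Set I) :
    colimOnMap (φ ≫ ψ) A = colimOnMap φ A ≫ colimOnMap ψ A := by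
  apply colim_hom_ext
  intro x
  rw [ι_colimOnMap, ← Category.assoc, ι_colimOnMap, Category.assoc, ι_colimOnMap,
    ← Category.assoc]
  rfl

theorem colimOnMap_zero (A : Set I) : colimOnMap (0 : G ⟶ H) A = 0 := by
  apply colim_hom_ext
  intro x
  rw [ι_colimOnMap, comp_zero]
  exact zero_comp

theorem colimMap_colimOnMap (φ : G ⟶ H) {A B : Set I} (h : A ⊆ B) :
    colimMap G h ≫ colimOnMap φ B = colimOnMap φ A ≫ colimMap H h := by
  apply colim_hom_ext
  intro x
  rw [← Category.assoc, ι_colimMap, ι_colimOnMap, ← Category.assoc, ι_colimOnMap, Category.assoc,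
    ι_colimMap]

theorem colimTo_app (φ : G ⟶ H) {A : Set I} {a : I} (h : ∀ x ∈ A, x ≤ a) :
    colimTo G h ≫ φ.app a = colimOnMap φ A ≫ colimTo H h := by
  apply colim_hom_ext
  intro x
  rw [← Category.assoc, ι_colimTo, ← Category.assoc, ι_colimOnMap, Category.assoc, ι_colimTo,
    φ.naturality]

theorem isIso_colimι {A : Set I} {y : I} (hy : y ∈ A) (hA : ∀ x ∈ A, x ≤ y) :
    IsIso (colimι G A ⟨y, hy⟩) := by
  refine ⟨colimTo G hA, ?_, ?_⟩
  · rw [ι_colimTo]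
    exact G.map_id y
  · apply colim_hom_ext
    intro x
    rw [← Category.assoc, ι_colimTo, Category.comp_id]
    exact map_colimι G A x ⟨y, hy⟩ (hA x x.2)

/-- Over a poset with a greatest element the colimit is evaluation there, hence exact; a general
colimit is only right exact. -/
theorem mono_colimOnMap (φ : G ⟶ H) [Mono φ] {A : Set I} {y : I} (hy : IsGreatest A y) :
    Mono (colimOnMap φ A) := by
  have := isIso_colimι (G := G) hy.1 fun x hx => hy.2 hx
  have := isIso_colimι (G := H) hy.1 fun x hx => hy.2 hx
  have h1 : Mono (φ.app y) := (NatTrans.mono_iff_mono_app φ).1 inferInstance y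
  have h : colimOnMap φ A =
      inv (colimι G A ⟨y, hy.1⟩) ≫ φ.app y ≫ colimι H A ⟨y, hy.1⟩ := by
    rw [IsIso.eq_inv_comp, ι_colimOnMap]
  rw [h]
  infer_instance

variable {a : I} {m : ℕ} (e : Fin m ≃ parents a)

/-- The map of terms of the Koszul complexes induced by a natural transformation. -/
def termMap (φ : G ⟶ H) (k : ℕ) : term G e k ⟶ term H e k :=
  termDesc G e fun σ => colimOnMap φ _ ≫ termι H e σ

theorem ι_termMap (φ : G ⟶ H) {k : ℕ} (σ : Index e k) :
    termι G e σ ≫ termMap e φ k = colimOnMap φ _ ≫ termι H e σ :=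
  termι_desc _ _ _ _

theorem termMap_comp (φ : G ⟶ H) (ψ : H ⟶ H') (k : ℕ) :
    termMap e (φ ≫ ψ) k = termMap e φ k ≫ termMap e ψ k := by
  apply term_hom_ext
  intro σ
  rw [ι_termMap, ← Category.assoc, ι_termMap, Category.assoc, ι_termMap, colimOnMap_comp,
    Category.assoc]

theorem termMap_zero (k : ℕ) : termMap e (0 : G ⟶ H) k = 0 := by
  apply term_hom_ext
  intro σ
  rw [ι_termMap, colimOnMap_zero, zero_comp, comp_zero]

theorem ι_diff {k : ℕ} (σ : Index e (k + 1)) :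
    termι G e σ ≫ diff G e k = ∑ j : Fin (k + 1), (-1 : ℤ) ^ (j : ℕ) • faceMap G e σ j :=
  termι_desc _ _ _ _

theorem ι_diffZero (σ : Index e 1) :
    termι G e σ ≫ diffZero G e = colimTo G (σ.le_of_mem e) :=
  termι_desc _ _ _ _

theorem diff_termMap (φ : G ⟶ H) (k : ℕ) :
    diff G e k ≫ termMap e φ k = termMap e φ (k + 1) ≫ diff H e k := by
  apply term_hom_ext
  intro σ
  rw [← Category.assoc, ι_diff, ← Category.assoc, ι_termMap, Category.assoc, ι_diff,
    Preadditive.sum_comp, Preadditive.comp_sum]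
  refine Finset.sum_congr rfl fun j _ => ?_
  rw [Preadditive.zsmul_comp, Preadditive.comp_zsmul, faceMap, faceMap, Category.assoc, ι_termMap,
    ← Category.assoc, colimMap_colimOnMap, Category.assoc]

theorem diffZero_app (φ : G ⟶ H) :
    diffZero G e ≫ φ.app a = termMap e φ 1 ≫ diffZero H e := by
  apply term_hom_ext
  intro σ
  rw [← Category.assoc, ι_diffZero, ← Category.assoc, ι_termMap, Category.assoc, ι_diffZero,
    colimTo_app]

variable (G) in
theorem koszulComplex_d_succ (k : ℕ) : (koszulComplex G e).d (k + 2) (k + 1) = diff G e (k + 1) :=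
  ChainComplex.of_d (fun k => term G e (k + 1)) (fun k => diff G e (k + 1)) k

/-- The component in degree `k` of the map of Koszul complexes. -/
def koszulMapF (φ : G ⟶ H) : ∀ k, (koszulComplex G e).X k ⟶ (koszulComplex H e).X k
  | 0 => φ.app a
  | k + 1 => termMap e φ (k + 1)

/-- The map of Koszul complexes induced by a natural transformation. -/
def koszulMap (φ : G ⟶ H) : koszulComplex G e ⟶ koszulComplex H e where
  f := koszulMapF e φ
  comm' := by
    rintro _ k rfl
    cases k with
    | zero =>
      exact (diffZero_app e φ).symm
    | succ k =>
      exact (congrArg (termMap e φ (k + 2) ≫ ·) (koszulComplex_d_succ H e k)).trans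
        ((diff_termMap e φ (k + 1)).symm.trans
          (congrArg (· ≫ termMap e φ (k + 1)) (koszulComplex_d_succ G e k)).symm)

theorem koszulMap_comp_eq_zero (φ : G ⟶ H) (ψ : H ⟶ H') (h : φ ≫ ψ = 0) :
    koszulMap e φ ≫ koszulMap e ψ = 0 := by
  ext k : 1
  cases k with
  | zero => exact congrArg (·.app a) h
  | succ k =>
    change termMap e φ (k + 1) ≫ termMap e ψ (k + 1) = 0
    rw [← termMap_comp, h, termMap_zero]

end Functoriality

section Exactness

variable {K : Type v} [Field K] {I : Type u} [PartialOrder I] [Finite I] {a : I} {m : ℕ}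
  (e : Fin m ≃ parents a) {S : ShortComplex (I ⥤ FGModuleCat.{v} K)}

theorem epi_termMap {G H : I ⥤ FGModuleCat.{v} K} (φ : G ⟶ H) [Epi φ] (k : ℕ) :
    Epi (termMap e φ k) := by
  constructor
  intro W u v huv
  apply term_hom_ext
  intro σ
  apply colim_hom_ext
  intro x
  have : Epi (φ.app (x : I)) := (NatTrans.epi_iff_epi_app φ).1 inferInstance _
  rw [← cancel_epi (φ.app (x : I))]
  have h := congrArg (fun t => colimι G _ x ≫ termι G e σ ≫ t) huv
  simp only [← Category.assoc] at h ⊢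
  simpa only [Category.assoc _ (termι G e σ), ι_termMap, ← Category.assoc, ι_colimOnMap] using h

/-- Right exactness of colimits and direct sums: a map that kills the term of `S.X₁` descends along
each `S.g.app x`, and the descended maps are compatible because `S.g` is epi at each `x`. -/
theorem exact_termMap (hS : S.ShortExact) (k : ℕ) :
    (ShortComplex.mk (termMap e S.f k) (termMap e S.g k)
      (by rw [← termMap_comp, S.zero, termMap_zero])).Exact := by
  have := hS.epi_g
  have := epi_termMap e S.g k
  have hx : ∀ x : I, (S.map ((evaluation I (FGModuleCat.{v} K)).obj x)).Exact := fun x =>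
    hS.exact.map _
  have hg : ∀ x : I, Epi (S.map ((evaluation I (FGModuleCat.{v} K)).obj x)).g := fun x =>
    (NatTrans.epi_iff_epi_app S.g).1 inferInstance x
  refine ShortComplex.exact_of_g_is_cokernel _ (CokernelCofork.IsColimit.ofπ' _ _ fun {W} φ hφ => ?_)
  have h0 : ∀ (σ : Index e k) (x : ancestors e σ.emb),
      S.f.app (x : I) ≫ colimι S.X₂ _ x ≫ termι S.X₂ e σ ≫ φ = 0 := by
    intro σ x
    have h := congrArg (fun t => colimι S.X₁ _ x ≫ termι S.X₁ e σ ≫ t) hφ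
    simp only [comp_zero] at h
    rw [← Category.assoc (termι S.X₁ e σ), ι_termMap, ← Category.assoc, ← Category.assoc,
      ι_colimOnMap, Category.assoc, Category.assoc] at h
    exact h
  let d : ∀ (σ : Index e k) (x : ancestors e σ.emb), S.X₃.obj x ⟶ W := fun σ x =>
    (hx x).desc _ (h0 σ x)
  have hd : ∀ (σ : Index e k) (x : ancestors e σ.emb),
      S.g.app (x : I) ≫ d σ x = colimι S.X₂ _ x ≫ termι S.X₂ e σ ≫ φ := fun σ x =>
    (hx x).g_desc _ (h0 σ x)
  have hd' : ∀ (σ : Index e k) (x y : ancestors e σ.emb) (h : (x : I) ≤ y),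
      S.X₃.map (homOfLE h) ≫ d σ y = d σ x := by
    intro σ x y h
    have : Epi (S.g.app (x : I)) := hg x
    rw [← cancel_epi (S.g.app (x : I)), ← Category.assoc, ← S.g.naturality, Category.assoc, hd, hd,
      ← Category.assoc, map_colimι]
  refine ⟨termDesc S.X₃ e fun σ => colimDesc S.X₃ _ (d σ) (hd' σ), ?_⟩
  apply term_hom_ext
  intro σ
  apply colim_hom_ext
  intro x
  rw [← Category.assoc (termι _ _ _), ι_termMap, Category.assoc, termι_desc, ← Category.assoc,
    ι_colimOnMap, Category.assoc, colimι_desc, hd]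

theorem mono_termMap {G H : I ⥤ FGModuleCat.{v} K} (φ : G ⟶ H) [Mono φ] (k : ℕ)
    (hk : ∀ σ : Index e k, ∃ y, IsGreatest (ancestors e σ.emb) y) : Mono (termMap e φ k) := by
  -- Injections of vector spaces split, and the retractions of the summands assemble to one of the
  -- direct sum.
  have hr : ∀ σ : Index e k, ∃ r : colimOn H (ancestors e σ.emb) ⟶ colimOn G (ancestors e σ.emb),
      colimOnMap φ _ ≫ r = 𝟙 _ := by
    intro σ
    obtain ⟨y, hy⟩ := hk σ
    have := (FGModuleCat.mono_iff_injective' _).1 (mono_colimOnMap φ hy)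
    obtain ⟨r, hr⟩ := LinearMap.exists_leftInverse_of_injective _ (LinearMap.ker_eq_bot.2 this)
    exact ⟨FGModuleCat.homMk r, FGModuleCat.hom_ext hr⟩
  choose r hr using hr
  have h : termMap e φ k ≫ termDesc H e (fun σ => r σ ≫ termι G e σ) = 𝟙 _ := by
    apply term_hom_ext
    intro σ
    rw [← Category.assoc, ι_termMap, Category.assoc, termι_desc, ← Category.assoc, hr,
      Category.id_comp, Category.comp_id]
  have : IsSplitMono (termMap e φ k) := IsSplitMono.mk' ⟨_, h⟩
  infer_instance

/-- The colimits in the Koszul complex are taken over posets with a greatest element in the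
degrees `≤ i`. -/
def HasGreatestAncestors (i : ℕ) : Prop :=
  ∀ k ≤ i, ∀ σ : Index e k, 0 < k → ∃ y, IsGreatest (ancestors e σ.emb) y

/-- The ancestors of a single parent `s` have greatest element `s`. Shifting from degree `i` uses
the degrees `< i` only, so this suffices up to `i = 2`. -/
theorem hasGreatestAncestors_one : HasGreatestAncestors e 1 := by
  intro k hk σ hk0
  obtain rfl : k = 1 := by omega
  refine ⟨e (σ.emb 0), ?_, fun x hx => hx ⟨0, rfl⟩⟩
  rintro _ ⟨j, rfl⟩
  rw [Subsingleton.elim j 0]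

/-- The join of all common ancestors of `S` is below each element of `S`, so it is again a common
ancestor. -/
theorem hasGreatestAncestors_of_isUpperSemilattice (hI : IsUpperSemilattice I) (i : ℕ) :
    HasGreatestAncestors e i := by
  intro k _ σ _
  obtain ⟨y, hy⟩ := hI (ancestors e σ.emb) (Set.toFinite _) σ.nonempty
  exact ⟨y, fun z hz => hy.2 fun x hx => hx hz, hy.1⟩

theorem HasGreatestAncestors.mono {i j : ℕ} (h : HasGreatestAncestors e i) (hij : j ≤ i) :
    HasGreatestAncestors e j := fun k hk => h k (hk.trans hij)

theorem epi_koszulMap_f {G H : I ⥤ FGModuleCat.{v} K} (φ : G ⟶ H) [Epi φ] (k : ℕ) :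
    Epi ((koszulMap e φ).f k) := by
  cases k with
  | zero => exact (NatTrans.epi_iff_epi_app φ).1 inferInstance a
  | succ k => exact epi_termMap e φ (k + 1)

theorem mono_koszulMap_f {G H : I ⥤ FGModuleCat.{v} K} (φ : G ⟶ H) [Mono φ] (k : ℕ)
    (hk : HasGreatestAncestors e k) : Mono ((koszulMap e φ).f k) := by
  cases k with
  | zero => exact (NatTrans.mono_iff_mono_app φ).1 inferInstance a
  | succ k => exact mono_termMap e φ (k + 1) fun σ => hk _ le_rfl σ k.succ_pos

theorem exact_koszulMap_f (hS : S.ShortExact) (k : ℕ) :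
    (ShortComplex.mk ((koszulMap e S.f).f k) ((koszulMap e S.g).f k)
      (congrArg (fun t => t.f k) (koszulMap_comp_eq_zero e S.f S.g S.zero))).Exact := by
  cases k with
  | zero => exact hS.exact.map ((evaluation I (FGModuleCat.{v} K)).obj a)
  | succ k => exact exact_termMap e hS (k + 1)

end Exactness

end Koszul

/-! ## The Koszul complex of a free functor is acyclic -/

namespace Koszul

variable {K : Type v} [Field K] {I : Type u} [PartialOrder I] {n : ℕ} (x : Fin n → I)

/-- A generator, as a morphism from the one-dimensional vector space. -/
def genHom (i : Fin n) : FGModuleCat.of K K ⟶ (freeOn K x).obj (x i) :=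
  FGModuleCat.homMk (V := FGModuleCat.of K K) (LinearMap.toSpanSingleton K _ (freeOn.gen x i))

/-- The map out of a value of a free functor that is given on the generators. -/
def freeDesc {W : FGModuleCat.{v} K} (w : Fin n → (FGModuleCat.of K K ⟶ W)) (y : I) :
    (freeOn K x).obj y ⟶ W :=
  FGModuleCat.homMk (∑ i, (LinearMap.proj i ∘ₗ freeOn.coeff x).smulRight
    ((w i).hom.hom (1 : K)))

theorem freeDesc_apply {W : FGModuleCat.{v} K} (w : Fin n → (FGModuleCat.of K K ⟶ W)) (y : I)
    (z : (freeOn K x).obj y) :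
    (freeDesc x w y).hom.hom z = ∑ i, freeOn.coeff x z i • (w i).hom.hom (1 : K) := by
  change (∑ i, (LinearMap.proj i ∘ₗ freeOn.coeff x).smulRight ((w i).hom.hom (1 : K))) z = _
  rw [LinearMap.sum_apply]
  rfl

theorem map_freeDesc {W : FGModuleCat.{v} K} (w : Fin n → (FGModuleCat.of K K ⟶ W)) {y y' : I}
    (h : y ⟶ y') : (freeOn K x).map h ≫ freeDesc x w y' = freeDesc x w y := by
  apply FGModuleCat.hom_ext
  apply LinearMap.ext
  intro z
  change (freeDesc x w y').hom.hom (((freeOn K x).map h).hom.hom z) = _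
  rw [freeDesc_apply, freeDesc_apply, freeOn.coeff_map]

theorem genHom_freeDesc {W : FGModuleCat.{v} K} (w : Fin n → (FGModuleCat.of K K ⟶ W))
    (i : Fin n) : genHom x i ≫ freeDesc x w (x i) = w i := by
  apply FGModuleCat.hom_ext
  apply LinearMap.ext_ring
  change (freeDesc x w (x i)).hom.hom ((1 : K) • freeOn.gen x i) = _
  rw [one_smul, freeDesc_apply, freeOn.coeff_gen, Finset.sum_eq_single i]
  · rw [Pi.single_eq_same, one_smul]
  · intro k _ hk
    rw [Pi.single_eq_of_ne hk, zero_smul]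
  · simp

theorem free_hom_ext {W : FGModuleCat.{v} K} {y : I} {φ ψ : (freeOn K x).obj y ⟶ W}
    (h : ∀ i (hi : x i ≤ y), genHom x i ≫ (freeOn K x).map (homOfLE hi) ≫ φ =
      genHom x i ≫ (freeOn K x).map (homOfLE hi) ≫ ψ) : φ = ψ := by
  apply FGModuleCat.hom_ext
  apply LinearMap.ext
  intro z
  rw [freeOn.eq_sum x z, map_sum, map_sum]
  refine Finset.sum_congr rfl fun i _ => ?_
  rw [map_smul, map_smul]
  by_cases hi : x i ≤ y
  · have h1 := FGModuleCat.hom_apply_eq (h i hi) (1 : K)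
    change φ.hom.hom (((freeOn K x).map (homOfLE hi)).hom.hom ((1 : K) • freeOn.gen x i)) =
      ψ.hom.hom (((freeOn K x).map (homOfLE hi)).hom.hom ((1 : K) • freeOn.gen x i)) at h1
    rw [one_smul] at h1
    rw [freeOn.transport_of_le _ hi, h1]
  · rw [freeOn.transport_of_not_le _ hi, map_zero, map_zero]

variable [Finite I] {a : I} {m : ℕ} (e : Fin m ≃ parents a)

theorem mem_ancestors {k : ℕ} {σ : Fin k ↪o Fin m} {y : I} :
    y ∈ ancestors e σ ↔ ∀ j, y ≤ e (σ j) :=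
  ⟨fun h j => h ⟨j, rfl⟩, by rintro h _ ⟨j, rfl⟩; exact h j⟩

open Classical in
/-- The basis element of a term of the Koszul complex that corresponds to the `i`-th generator and
the subset `σ`; it is zero if the generator is not an ancestor of the subset. -/
def cls (i : Fin n) {k : ℕ} (σ : Fin k ↪o Fin m) : FGModuleCat.of K K ⟶ term (freeOn K x) e k :=
  if h : x i ∈ ancestors e σ then
    genHom x i ≫ colimι (freeOn K x) (ancestors e σ) ⟨x i, h⟩ ≫
      termι (freeOn K x) e (⟨σ, ⟨_, h⟩⟩ : Index e k)
  else 0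

theorem cls_of_mem {i : Fin n} {k : ℕ} (σ : Index e k) (h : x i ∈ ancestors e σ.emb) :
    cls (K := K) x e i σ.emb = genHom x i ≫ colimι (freeOn K x) (ancestors e σ.emb) ⟨x i, h⟩ ≫
      termι (freeOn K x) e σ :=
  dif_pos h

/-- The classes `cls x e i σ` with `x i` below `σ` generate the term. For fixed `i` they are the
faces of the simplex on the parents above `x i`. -/
theorem term_free_hom_ext {k : ℕ} {W : FGModuleCat.{v} K} {φ ψ : term (freeOn K x) e k ⟶ W}
    (h : ∀ i (σ : Fin k ↪o Fin m), x i ∈ ancestors e σ → cls x e i σ ≫ φ = cls x e i σ ≫ ψ) :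
    φ = ψ := by
  apply term_hom_ext
  intro σ
  apply colim_hom_ext
  intro y
  apply free_hom_ext
  intro i hi
  have hm : x i ∈ ancestors e σ.emb := fun z hz => hi.trans (y.2 hz)
  have h1 := h i σ.emb hm
  rw [cls_of_mem x e σ hm] at h1
  have h2 : (freeOn K x).map (homOfLE hi) ≫ colimι (freeOn K x) _ y =
    colimι (freeOn K x) (ancestors e σ.emb) ⟨x i, hm⟩ :=
      map_colimι (freeOn K x) (ancestors e σ.emb) ⟨x i, hm⟩ y hi
  rw [← Category.assoc ((freeOn K x).map _), ← Category.assoc ((freeOn K x).map _), h2]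
  simpa only [Category.assoc] using h1

/-- The subset without its `j`-th element. -/
abbrev faceEmb {k : ℕ} (σ : Fin (k + 1) ↪o Fin m) (j : Fin (k + 1)) : Fin k ↪o Fin m :=
  (Fin.succAboveOrderEmb j).trans σ

theorem cls_diff {i : Fin n} {k : ℕ} (σ : Fin (k + 1) ↪o Fin m) (h : x i ∈ ancestors e σ) :
    cls x e i σ ≫ diff (freeOn K x) e k =
      ∑ j : Fin (k + 1), (-1 : ℤ) ^ (j : ℕ) • cls x e i (faceEmb σ j) := by
  let σ' : Index e (k + 1) := ⟨σ, ⟨_, h⟩⟩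
  change cls x e i σ'.emb ≫ _ = _
  rw [cls_of_mem x e σ' h, Category.assoc, Category.assoc, ι_diff, Preadditive.comp_sum,
    Preadditive.comp_sum]
  refine Finset.sum_congr rfl fun j _ => ?_
  rw [Preadditive.comp_zsmul, Preadditive.comp_zsmul]
  congr 1
  have hm : x i ∈ ancestors e (σ'.face e j).emb := σ'.ancestors_face e j h
  refine Eq.trans ?_ (cls_of_mem x e (σ'.face e j) hm).symm
  rw [faceMap, ← Category.assoc (colimι _ _ _), ι_colimMap]

theorem cls_diffZero {i : Fin n} (σ : Fin 1 ↪o Fin m) (h : x i ∈ ancestors e σ) (ha : x i ≤ a) :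
    cls x e i σ ≫ diffZero (freeOn K x) e = genHom x i ≫ (freeOn K x).map (homOfLE ha) := by
  let σ' : Index e 1 := ⟨σ, ⟨_, h⟩⟩
  change cls x e i σ'.emb ≫ _ = _
  rw [cls_of_mem x e σ' h, Category.assoc, Category.assoc, ι_diffZero, ι_colimTo]

/-- Add an element in front of a subset. -/
def consEmb {k : ℕ} (s : Fin m) (σ : Fin k ↪o Fin m) (h : ∀ j, s < σ j) :
    Fin (k + 1) ↪o Fin m :=
  OrderEmbedding.ofStrictMono (Fin.cons s σ : Fin (k + 1) → Fin m) (by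
    intro i j hij
    induction j using Fin.cases with
    | zero => exact absurd hij (Fin.not_lt_zero i)
    | succ j =>
      induction i using Fin.cases with
      | zero => simpa using h j
      | succ i => simpa using hij)

theorem faceEmb_consEmb_zero {k : ℕ} (s : Fin m) (σ : Fin k ↪o Fin m) (h : ∀ j, s < σ j) :
    faceEmb (consEmb s σ h) 0 = σ := by
  ext j : 1
  change (Fin.cons s σ : Fin (k + 1) → Fin m) (Fin.succAbove 0 j) = σ j
  simp

theorem faceEmb_consEmb_succ {k : ℕ} (s : Fin m) (σ : Fin (k + 1) ↪o Fin m) (h : ∀ j, s < σ j)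
    (j : Fin (k + 1)) :
    faceEmb (consEmb s σ h) j.succ = consEmb s (faceEmb σ j) fun _ => h _ := by
  ext l : 1
  change (Fin.cons s σ : Fin (k + 2) → Fin m) (Fin.succAbove j.succ l) =
    (Fin.cons s (faceEmb σ j) : Fin (k + 1) → Fin m) l
  induction l using Fin.cases with
  | zero => simp
  | succ l => simp

theorem consEmb_faceEmb_zero {k : ℕ} (σ : Fin (k + 1) ↪o Fin m)
    (h : ∀ j, σ 0 < faceEmb σ 0 j) : consEmb (σ 0) (faceEmb σ 0) h = σ := by
  ext l : 1
  change (Fin.cons (σ 0) (faceEmb σ 0) : Fin (k + 1) → Fin m) l = σ l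
  induction l using Fin.cases with
  | zero => simp
  | succ l => simp

/-- `s` is the first parent above the `i`-th generator. -/
def IsLead (i : Fin n) (s : Fin m) : Prop := IsLeast {s | x i ≤ e s} s

open Classical in
/-- The value of the contracting homotopy on a basis element. -/
def hcls (i : Fin n) {k : ℕ} (σ : Fin k ↪o Fin m) :
    FGModuleCat.of K K ⟶ term (freeOn K x) e (k + 1) :=
  if h : ∃ s, IsLead x e i s ∧ ∀ j, s < σ j then cls x e i (consEmb h.choose σ h.choose_spec.2)
  else 0

theorem hcls_eq_cls {i : Fin n} {k : ℕ} {σ : Fin k ↪o Fin m} {s : Fin m} (hs : IsLead x e i s)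
    (h : ∀ j, s < σ j) : hcls (K := K) x e i σ = cls x e i (consEmb s σ h) := by
  have hex : ∃ s, IsLead x e i s ∧ ∀ j, s < σ j := ⟨s, hs, h⟩
  have heq : hex.choose = s := hex.choose_spec.1.unique hs
  rw [hcls, dif_pos hex]
  congr 2

theorem hcls_eq_zero {i : Fin n} {k : ℕ} {σ : Fin k ↪o Fin m} {s : Fin m} (hs : IsLead x e i s)
    (j : Fin k) (h : σ j = s) : hcls (K := K) x e i σ = 0 := by
  rw [hcls, dif_neg]
  rintro ⟨s', hs', h'⟩
  rw [hs'.unique hs] at h'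
  exact (h' j).ne h.symm

/-- This is the contraction of a simplex to a vertex `s`, the first parent above `x i`. If `s` is
not in `σ`, the boundary of `sσ` is `σ` minus the cone on the boundary of `σ`. If `s` is in `σ` it
is its first element, the cone on `σ` is zero, and of the faces only the one omitting `s` has a
non-zero cone, namely `σ`. -/
theorem hcls_diff {i : Fin n} {k : ℕ} (σ : Fin (k + 1) ↪o Fin m) (h : x i ∈ ancestors e σ) :
    hcls x e i σ ≫ diff (freeOn K x) e (k + 1) +
      ∑ j : Fin (k + 1), (-1 : ℤ) ^ (j : ℕ) • hcls x e i (faceEmb σ j) = cls x e i σ := by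
  rw [mem_ancestors] at h
  obtain ⟨s, hs⟩ : ∃ s, IsLead x e i s := by
    obtain ⟨s, hs⟩ := (Set.toFinite {s | x i ≤ e s}).exists_minimal ⟨σ 0, h 0⟩
    exact ⟨s, hs.1, fun t ht => (le_total s t).elim id fun h' => hs.2 ht h'⟩
  obtain hlt | heq := (hs.2 (h 0)).lt_or_eq
  · have hall : ∀ j, s < σ j := fun j => hlt.trans_le (σ.monotone (Fin.zero_le j))
    have hface : ∀ j l, s < faceEmb σ j l := fun j l => hall _
    rw [hcls_eq_cls x e hs hall, cls_diff x e _ (by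
      rw [mem_ancestors]
      intro j
      induction j using Fin.cases with
      | zero => exact hs.1
      | succ j => exact h j), Fin.sum_univ_succ, faceEmb_consEmb_zero]
    simp only [Fin.val_zero, pow_zero, one_smul, Fin.val_succ, pow_succ, mul_neg_one, neg_smul,
      Finset.sum_neg_distrib, faceEmb_consEmb_succ]
    rw [add_assoc, add_eq_left, neg_add_eq_zero]
    refine Finset.sum_congr rfl fun j _ => ?_
    rw [hcls_eq_cls x e hs (hface j)]
  · subst heq
    have hpos : ∀ j, σ 0 < faceEmb σ 0 j := fun j => σ.strictMono (by simp)
    rw [hcls_eq_zero x e hs 0 rfl, zero_comp, zero_add, Fin.sum_univ_succ,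
      hcls_eq_cls x e hs hpos, consEmb_faceEmb_zero, Finset.sum_eq_zero]
    · simp
    · intro j _
      obtain _ | k := k
      · exact j.elim0
      · rw [hcls_eq_zero x e hs 0, smul_zero]
        change σ (Fin.succAbove j.succ 0) = σ 0
        simp

/-- The contracting homotopy in positive degrees. -/
def homotopyTerm (k : ℕ) : term (freeOn K x) e k ⟶ term (freeOn K x) e (k + 1) :=
  termDesc _ e fun σ => colimDesc _ _ (fun y => freeDesc x (fun i => hcls x e i σ.emb) y)
    fun _ _ h => map_freeDesc x _ (homOfLE h)

theorem cls_homotopyTerm {i : Fin n} {k : ℕ} (σ : Fin k ↪o Fin m) (h : x i ∈ ancestors e σ) :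
    cls x e i σ ≫ homotopyTerm (K := K) x e k = hcls x e i σ := by
  let σ' : Index e k := ⟨σ, ⟨_, h⟩⟩
  change cls x e i σ'.emb ≫ _ = hcls x e i σ'.emb
  rw [cls_of_mem x e σ' h, homotopyTerm, Category.assoc, Category.assoc, termι_desc, colimι_desc,
    genHom_freeDesc]

/-- The contracting homotopy in degree zero. -/
def homotopyZero : (freeOn K x).obj a ⟶ term (freeOn K x) e 1 :=
  freeDesc x (fun i => hcls x e i (RelEmbedding.ofIsEmpty (α := Fin 0) _ _)) a

theorem homotopy_succ (k : ℕ) :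
    homotopyTerm x e (k + 2) ≫ diff (freeOn K x) e (k + 2) +
      diff (freeOn K x) e (k + 1) ≫ homotopyTerm x e (k + 1) = 𝟙 _ := by
  apply term_free_hom_ext
  intro i σ h
  rw [Preadditive.comp_add, ← Category.assoc, cls_homotopyTerm x e σ h, ← Category.assoc,
    cls_diff x e σ h, Preadditive.sum_comp, Category.comp_id, ← hcls_diff x e σ h]
  congr 1
  refine Finset.sum_congr rfl fun j _ => ?_
  rw [Preadditive.zsmul_comp, cls_homotopyTerm x e _ (ancestors_face e σ j h)]

theorem homotopy_zero :
    homotopyTerm x e 1 ≫ diff (freeOn K x) e 1 +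
      diffZero (freeOn K x) e ≫ homotopyZero x e = 𝟙 _ := by
  apply term_free_hom_ext
  intro i σ h
  have ha : x i ≤ a := ((mem_ancestors e).1 h 0).trans (e (σ 0)).2.le
  rw [Preadditive.comp_add, ← Category.assoc, cls_homotopyTerm x e σ h, ← Category.assoc,
    cls_diffZero x e σ h ha, Category.comp_id, ← hcls_diff x e σ h, Category.assoc, homotopyZero,
    map_freeDesc, genHom_freeDesc, Fin.sum_univ_one]
  simp only [Fin.val_zero, pow_zero, one_smul]
  congr 2
  exact DFunLike.ext _ _ fun l => l.elim0

theorem exact_of_homotopy {X Y Z : FGModuleCat.{v} K} {f : X ⟶ Y} {g : Y ⟶ Z} (w : f ≫ g = 0)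
    (h : Y ⟶ X) (h' : Z ⟶ Y) (hh : h ≫ f + g ≫ h' = 𝟙 _) : (ShortComplex.mk f g w).Exact := by
  rw [ShortComplex.exact_iff_exact_up_to_refinements]
  intro A z hz
  refine ⟨A, 𝟙 A, inferInstance, z ≫ h, ?_⟩
  have := congrArg (z ≫ ·) hh
  simp only [Preadditive.comp_add, Category.comp_id] at this
  change z ≫ g = 0 at hz
  rw [← Category.assoc z g, hz, zero_comp, add_zero] at this
  change 𝟙 A ≫ z = (z ≫ h) ≫ f
  rw [Category.id_comp, Category.assoc, this]

theorem exactAt_koszulComplex_freeOn (k : ℕ) :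
    (koszulComplex (freeOn K x) e).ExactAt (k + 1) := by
  rw [HomologicalComplex.exactAt_iff' _ (k + 2) (k + 1) k (by simp) (by simp)]
  have hcongr : ∀ {X Y Z : FGModuleCat.{v} K} {f f' : X ⟶ Y} {g g' : Y ⟶ Z} (w : f ≫ g = 0)
      (w' : f' ≫ g' = 0), f = f' → g = g' → (ShortComplex.mk f' g' w').Exact →
        (ShortComplex.mk f g w).Exact := by
    rintro X Y Z f f' g g' w w' rfl rfl h
    exact h
  cases k with
  | zero =>
    exact hcongr _ (diff_diffZero _ e) (koszulComplex_d_succ _ e 0) rfl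
      (exact_of_homotopy _ _ _ (homotopy_zero x e))
  | succ k =>
    exact hcongr _ (diff_diff _ e (k + 1)) (koszulComplex_d_succ _ e (k + 1))
      (koszulComplex_d_succ _ e k) (exact_of_homotopy _ _ _ (homotopy_succ x e k))

end Koszul

/-! ## Dimension shifting -/

section Shift

variable {C : Type*} [Category C] [Abelian C] {A B D : ChainComplex C ℕ} (f : A ⟶ B) (g : B ⟶ D)
  (w : f ≫ g = 0)

/-- A right exact sequence of complexes becomes short exact on replacing its first term by a
kernel. -/
theorem shortExact_kernel_of_epi_f (hg : ∀ k, Epi (g.f k)) :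
    (ShortComplex.mk (kernel.ι g) g (kernel.condition g)).ShortExact where
  exact := ShortComplex.exact_kernel g
  epi_g := HomologicalComplex.epi_of_epi_f g hg

include w in
theorem epi_kernelLift_f (hg : ∀ k, Epi (g.f k)) (k : ℕ)
    (hex : (ShortComplex.mk (f.f k) (g.f k) (congrArg (fun t => t.f k) w)).Exact) :
    Epi ((kernel.lift g f w).f k) := by
  have hT := (shortExact_kernel_of_epi_f g hg).map_of_exact (HomologicalComplex.eval C _ k)
  have hm : Mono ((kernel.ι g).f k) := hT.mono_f
  have hl : (kernel.lift g f w).f k ≫ (kernel.ι g).f k = f.f k :=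
    congrArg (fun t => t.f k) (kernel.lift_ι g f w)
  have hι : (kernel.ι g).f k ≫ g.f k = 0 := congrArg (fun t => t.f k) (kernel.condition g)
  rw [epi_iff_surjective_up_to_refinements]
  intro W y
  obtain ⟨W', π, hπ, z, hz⟩ := hex.exact_up_to_refinements (y ≫ (kernel.ι g).f k) (by
    change (y ≫ (kernel.ι g).f k) ≫ g.f k = 0
    rw [Category.assoc, hι, comp_zero])
  refine ⟨W', π, hπ, z, ?_⟩
  rw [← cancel_mono ((kernel.ι g).f k), Category.assoc, Category.assoc, hl]
  exact hz

include w in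
-- The lift to the kernel is epi in all degrees and mono in degrees `≤ i`. An epi in degree `i + 1`,
-- an isomorphism in degree `i` and a mono in degree `i - 1` induce an isomorphism on `H_i`.
theorem isIso_homologyMap_kernelLift (hg : ∀ k, Epi (g.f k))
    (hex : ∀ k, (ShortComplex.mk (f.f k) (g.f k) (congrArg (fun t => t.f k) w)).Exact) (i : ℕ)
    (hm : ∀ k ≤ i, Mono (f.f k)) :
    IsIso (HomologicalComplex.homologyMap (kernel.lift g f w) i) := by
  have he : ∀ k, Epi ((kernel.lift g f w).f k) := fun k => epi_kernelLift_f f g w hg k (hex k)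
  have hm' : ∀ k ≤ i, Mono ((kernel.lift g f w).f k) := fun k hk => by
    have := hm k hk
    exact mono_of_mono_fac (congrArg (fun t => t.f k) (kernel.lift_ι g f w))
  -- For `i = 0` the truncated `i - 1` is `0`, which is also the index that the complex shape
  -- assigns after `0`.
  rw [← quasiIsoAt_iff_isIso_homologyMap, quasiIsoAt_iff' _ (i + 1) i (i - 1) (by simp) (by
    cases i <;> simp)]
  let φ := (HomologicalComplex.shortComplexFunctor' C (ComplexShape.down ℕ) (i + 1) i (i - 1)).map
    (kernel.lift g f w)
  have h1 : Epi φ.τ₁ := he (i + 1)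
  have h2 : IsIso φ.τ₂ := by
    have h2 : Mono φ.τ₂ := hm' i le_rfl
    have h2' : Epi φ.τ₂ := he i
    exact isIso_of_mono_of_epi _
  have h3 : Mono φ.τ₃ := hm' (i - 1) (by omega)
  exact ShortComplex.quasiIso_of_epi_of_isIso_of_mono φ

include w in
/-- Dimension shifting along a right exact sequence of complexes whose middle term is acyclic in
positive degrees. -/
theorem nonempty_homology_shift (hg : ∀ k, Epi (g.f k))
    (hex : ∀ k, (ShortComplex.mk (f.f k) (g.f k) (congrArg (fun t => t.f k) w)).Exact)
    (hB : ∀ k, B.ExactAt (k + 1)) (h0 : HomologicalComplex.homologyMap f 0 = 0) (i : ℕ)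
    (hm : ∀ k ≤ i, Mono (f.f k)) :
    Nonempty (D.homology (i + 1) ≅ A.homology i) := by
  have hT := shortExact_kernel_of_epi_f g hg
  have hij : (ComplexShape.down ℕ).Rel (i + 1) i := by simp
  have hl := isIso_homologyMap_kernelLift f g w hg hex i hm
  have hmono := hT.mono_δ (i + 1) i hij (hB i).isZero_homology
  have hepi : Epi (hT.δ (i + 1) i hij) := by
    -- The connecting map is onto because `H_i` of the kernel maps to `H_i B` by zero: for `i > 0`
    -- by acyclicity of `B`, for `i = 0` by `h0`.
    refine (hT.homology_exact₁ (i + 1) i hij).epi_f ?_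
    change HomologicalComplex.homologyMap (kernel.ι g) i = 0
    cases i with
    | zero =>
      rw [← cancel_epi (HomologicalComplex.homologyMap (kernel.lift g f w) 0),
        ← HomologicalComplex.homologyMap_comp, kernel.lift_ι, h0, comp_zero]
    | succ i => exact (hB i).isZero_homology.eq_of_tgt _ _
  have : IsIso (hT.δ (i + 1) i hij) := isIso_of_mono_of_epi _
  exact ⟨asIso (hT.δ (i + 1) i hij) ≪≫ (asIso
    (HomologicalComplex.homologyMap (kernel.lift g f w) i)).symm⟩

include w in
theorem nonempty_homology_zero_iso (hg : ∀ k, Epi (g.f k))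
    (hex : ∀ k, (ShortComplex.mk (f.f k) (g.f k) (congrArg (fun t => t.f k) w)).Exact)
    (h0 : HomologicalComplex.homologyMap f 0 = 0) (hm : Mono (f.f 0)) :
    Nonempty (D.homology 0 ≅ B.homology 0) := by
  have hT := shortExact_kernel_of_epi_f g hg
  have hl := isIso_homologyMap_kernelLift f g w hg hex 0 fun k hk => by
    obtain rfl : k = 0 := by omega
    exact hm
  have hmono : Mono (HomologicalComplex.homologyMap g 0) := by
    refine (hT.homology_exact₂ 0).mono_g ?_
    change HomologicalComplex.homologyMap (kernel.ι g) 0 = 0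
    rw [← cancel_epi (HomologicalComplex.homologyMap (kernel.lift g f w) 0),
      ← HomologicalComplex.homologyMap_comp, kernel.lift_ι, h0, comp_zero]
  have := hg 0
  have : Epi (HomologicalComplex.homologyMap g 0) :=
    HomologicalComplex.epi_homologyMap_of_epi_of_not_rel g 0 (by simp)
  have : IsIso (HomologicalComplex.homologyMap g 0) := isIso_of_mono_of_epi _
  exact ⟨(asIso (HomologicalComplex.homologyMap g 0)).symm⟩

end Shift

/-! ## The Koszul complex along a radical cover -/

namespace freeOn

variable {K : Type v} [Field K] {J : Type u} [PartialOrder J]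

/-- The coefficients at the generators that sit at `a`. -/
def fiberCoeff {n : ℕ} (x : Fin n → J) (a : J) :
    (freeOn K x).obj a →ₗ[K] ({i : Fin n // x i = a} → K) :=
  LinearMap.funLeft K K Subtype.val ∘ₗ coeff x

theorem fiberCoeff_apply {n : ℕ} (x : Fin n → J) (a : J) (c : (freeOn K x).obj a)
    (i : {i : Fin n // x i = a}) : fiberCoeff x a c i = coeff x c i := rfl

theorem fiberCoeff_fiberι {n : ℕ} (x : Fin n → J) (a : J) (w : {i : Fin n // x i = a} → K) :
    fiberCoeff x a (fiberι x a w) = w := by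
  ext i
  rw [fiberCoeff_apply, coeff_fiberι, dif_pos i.2]

theorem fiberCoeff_surjective {n : ℕ} (x : Fin n → J) (a : J) :
    Function.Surjective (fiberCoeff (K := K) x a) := fun w => ⟨_, fiberCoeff_fiberι x a w⟩

/-- Morphisms preserve the radical: a generator strictly below `a` goes to a combination of
generators that are at or below its own position. So the number of generators at `a` is an
isomorphism invariant. -/
theorem fiberCoeff_eq_zero_of_app {n m : ℕ} {x : Fin n → J} {y : Fin m → J}
    (φ : freeOn K x ⟶ freeOn K y) {a : J} {c : (freeOn K x).obj a} (h : fiberCoeff x a c = 0) :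
    fiberCoeff y a ((φ.app a).hom.hom c) = 0 := by
  ext ⟨l, rfl⟩
  rw [fiberCoeff_apply, coeff_app, Finset.sum_eq_zero, Pi.zero_apply]
  intro i _
  by_cases hi : x i = y l
  · rw [← fiberCoeff_apply x (y l) c ⟨i, hi⟩, h, Pi.zero_apply, zero_mul]
  · by_cases hle : x i ≤ y l
    · rw [coeff_eq_zero y _ fun h' => hi (le_antisymm hle h'), mul_zero]
    · rw [coeff_eq_zero x c hle, zero_mul]

theorem card_fiber_le {n m : ℕ} {x : Fin n → J} {y : Fin m → J}
    (φ : freeOn K x ⟶ freeOn K y) [Epi φ] (a : J) :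
    Nat.card {i : Fin m // y i = a} ≤ Nat.card {i : Fin n // x i = a} := by
  classical
  have hs : Function.Surjective (fiberCoeff y a ∘ₗ (φ.app a).hom.hom ∘ₗ fiberι x a) := by
    intro w
    obtain ⟨d, rfl⟩ := fiberCoeff_surjective (K := K) y a w
    obtain ⟨c, rfl⟩ := (functor_epi_iff_surjective φ).1 inferInstance a d
    refine ⟨fiberCoeff x a c, ?_⟩
    have h : fiberCoeff x a (fiberι x a (fiberCoeff x a c) - c) = 0 := by
      rw [map_sub, fiberCoeff_fiberι, sub_self]
    have := fiberCoeff_eq_zero_of_app φ h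
    rwa [map_sub, map_sub, sub_eq_zero] at this
  have := LinearMap.finrank_le_finrank_of_surjective hs
  rwa [Module.finrank_fintype_fun_eq_card, Module.finrank_fintype_fun_eq_card,
    ← Nat.card_eq_fintype_card, ← Nat.card_eq_fintype_card] at this

theorem card_fiber_eq {n m : ℕ} {x : Fin n → J} {y : Fin m → J}
    (e : freeOn K x ≅ freeOn K y) (a : J) :
    Nat.card {i : Fin n // x i = a} = Nat.card {i : Fin m // y i = a} :=
  le_antisymm (card_fiber_le e.inv a) (card_fiber_le e.hom a)

theorem IsRadical.fiberCoeff_eq_zero {M : J ⥤ FGModuleCat.{v} K} {n : ℕ} {x : Fin n → J}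
    {p : freeOn K x ⟶ M} (hp : IsRadical p) {a : J} (c : (freeOn K x).obj a)
    (h : (p.app a).hom.hom c = 0) : fiberCoeff x a c = 0 := by
  ext ⟨i, rfl⟩
  exact hp i c h

end freeOn

namespace Koszul

variable {K : Type v} [Field K] {I : Type u} [PartialOrder I] [Finite I] {n : ℕ} (x : Fin n → I)
  {a : I} {m : ℕ} (e : Fin m ≃ parents a)

/-- The projection of a free functor at `a` to the span of the generators that sit at `a`. -/
def fiberProj : (freeOn K x).obj a ⟶ FGModuleCat.of K ({i : Fin n // x i = a} → K) :=
  FGModuleCat.homMk (W := FGModuleCat.of K ({i : Fin n // x i = a} → K)) (freeOn.fiberCoeff x a)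

theorem diffZero_fiberProj : diffZero (freeOn K x) e ≫ fiberProj x = 0 := by
  apply term_free_hom_ext
  intro i σ h
  have hle := (mem_ancestors e).1 h 0
  have ha : x i ≤ a := hle.trans (e (σ 0)).2.le
  rw [← Category.assoc, cls_diffZero x e σ h ha, comp_zero]
  apply FGModuleCat.hom_ext
  apply LinearMap.ext_ring
  ext ⟨l, hl⟩
  change freeOn.coeff (K := K) x ((1 : K) • freeOn.gen x i) l = 0
  rw [one_smul, freeOn.coeff_gen, Pi.single_eq_of_ne]
  rintro rfl
  exact (hle.trans_lt (e (σ 0)).2.lt).ne hl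

theorem exact_diffZero_fiberProj :
    (ShortComplex.mk (diffZero (freeOn K x) e) (fiberProj x) (diffZero_fiberProj x e)).Exact := by
  rw [FGModuleCat.exact_iff_function_exact]
  intro c
  constructor
  · intro hc
    change c ∈ LinearMap.range (diffZero (freeOn K x) e).hom.hom
    rw [freeOn.eq_sum x c]
    refine Submodule.sum_mem _ fun i _ => ?_
    by_cases hi : x i ≤ a
    · obtain hlt | heq := hi.lt_or_eq
      · refine Submodule.smul_mem _ _ ?_
        -- By finiteness of `I`, a generator strictly below `a` lies below a parent, so it is hit
        -- from degree 1.
        obtain ⟨s, hs, hsa⟩ := exists_le_covBy_of_lt hlt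
        obtain ⟨t, ht⟩ := e.surjective ⟨s, hsa⟩
        let σ : Fin 1 ↪o Fin m :=
          OrderEmbedding.ofStrictMono (fun _ => t) fun i j h => absurd h (by omega)
        have hσ : x i ∈ ancestors e σ := (mem_ancestors e).2 fun _ => by
          change x i ≤ e t
          rw [ht]
          exact hs
        have h := FGModuleCat.hom_apply_eq (cls_diffZero (K := K) x e σ hσ hi) (1 : K)
        rw [freeOn.transport_of_le _ hi]
        refine ⟨_, h.trans ?_⟩
        exact congrArg ((freeOn K x).map (homOfLE hi)).hom.hom (one_smul K _)
      · have h : freeOn.coeff x c i = 0 := congrFun hc ⟨i, heq⟩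
        rw [h, zero_smul]
        exact Submodule.zero_mem _
    · rw [freeOn.transport_of_not_le _ hi, smul_zero]
      exact Submodule.zero_mem _
  · rintro ⟨z, rfl⟩
    exact FGModuleCat.hom_apply_eq (diffZero_fiberProj x e) z

theorem epi_fiberProj : Epi (fiberProj (K := K) (a := a) x) :=
  (FGModuleCat.epi_iff_surjective' _).2 (freeOn.fiberCoeff_surjective x a)

/-- In degree zero the homology of the Koszul complex of a free functor is the span of the
generators that sit at `a`. -/
theorem nonempty_homology_zero_freeOn : Nonempty ((koszulComplex (freeOn K x) e).homology 0 ≅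
    FGModuleCat.of K ({i : Fin n // x i = a} → K)) := by
  have : Epi (ShortComplex.mk (diffZero (freeOn K x) e) (fiberProj x)
    (diffZero_fiberProj x e)).g := epi_fiberProj x
  have hd : diffZero (freeOn K x) e ≫ (koszulComplex (freeOn K x) e).pOpcycles 0 = 0 :=
    (koszulComplex (freeOn K x) e).d_pOpcycles 1 0
  have hc : IsColimit (CokernelCofork.ofπ _ hd) :=
    (koszulComplex (freeOn K x) e).opcyclesIsCokernel 1 0 (by simp)
  exact ⟨ChainComplex.isoHomologyι₀ _ ≪≫ IsColimit.coconePointUniqueUpToIso hc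
    (exact_diffZero_fiberProj x e).gIsCokernel⟩

/-- `H_0` of the free functor only sees coefficients at generators sitting at `a`, and radicality
says that these vanish on the kernel of `p`. -/
theorem homologyMap_koszulMap_zero {N M : I ⥤ FGModuleCat.{v} K} {x : Fin n → I}
    (ι : N ⟶ freeOn K x) (p : freeOn K x ⟶ M) (w : ι ≫ p = 0) (hp : freeOn.IsRadical p) :
    HomologicalComplex.homologyMap (koszulMap e ι) 0 = 0 := by
  have : Epi (ShortComplex.mk (diffZero (freeOn K x) e) (fiberProj x)
    (diffZero_fiberProj x e)).g := epi_fiberProj x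
  have h0 : ι.app a ≫ fiberProj x = 0 := by
    apply FGModuleCat.hom_ext
    apply LinearMap.ext
    intro z
    exact hp.fiberCoeff_eq_zero _ (FGModuleCat.hom_apply_eq (congrArg (·.app a) w) z)
  have hz : (koszulComplex (freeOn K x) e).d 1 0 ≫
      (koszulComplex (freeOn K x) e).pOpcycles 0 = 0 := HomologicalComplex.d_pOpcycles _ _ _
  have hfac : fiberProj x ≫ (exact_diffZero_fiberProj x e).desc _ hz =
      (koszulComplex (freeOn K x) e).pOpcycles 0 :=
    (exact_diffZero_fiberProj x e).g_desc _ hz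
  have h1 : (koszulMap e ι).f 0 ≫ (koszulComplex (freeOn K x) e).pOpcycles 0 = 0 := by
    rw [← hfac]
    exact (Category.assoc (ι.app a) (fiberProj x) _).symm.trans
      ((congrArg (· ≫ _) h0).trans zero_comp)
  rw [← cancel_epi (HomologicalComplex.homologyπ _ 0), ← cancel_mono
    (HomologicalComplex.homologyι _ 0)]
  simp [h1]

variable {x}

/-- Dimension shifting for the Koszul complex. -/
theorem nonempty_homology_succ_iso {N M : I ⥤ FGModuleCat.{v} K}
    {ι : N ⟶ freeOn K x} {p : freeOn K x ⟶ M} {w : ι ≫ p = 0}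
    (hS : (ShortComplex.mk ι p w).ShortExact) (hp : freeOn.IsRadical p) (i : ℕ)
    (hi : HasGreatestAncestors e i) :
    Nonempty ((koszulComplex M e).homology (i + 1) ≅ (koszulComplex N e).homology i) := by
  have := hS.epi_g
  have : Epi p := hS.epi_g
  have : Mono ι := hS.mono_f
  exact nonempty_homology_shift (koszulMap e ι) (koszulMap e p) (koszulMap_comp_eq_zero e _ _ w)
    (epi_koszulMap_f e p) (exact_koszulMap_f e hS) (exactAt_koszulComplex_freeOn x e)
    (homologyMap_koszulMap_zero e ι p w hp) i
    fun k hk => mono_koszulMap_f e ι k (hi.mono e hk)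

theorem nonempty_homology_zero_iso_fiber {N M : I ⥤ FGModuleCat.{v} K}
    {ι : N ⟶ freeOn K x} {p : freeOn K x ⟶ M} {w : ι ≫ p = 0}
    (hS : (ShortComplex.mk ι p w).ShortExact) (hp : freeOn.IsRadical p) :
    Nonempty ((koszulComplex M e).homology 0 ≅
      FGModuleCat.of K ({i : Fin n // x i = a} → K)) := by
  have : Epi p := hS.epi_g
  have : Mono ι := hS.mono_f
  obtain ⟨φ⟩ := nonempty_homology_zero_iso (koszulMap e ι) (koszulMap e p)
    (koszulMap_comp_eq_zero e _ _ w) (epi_koszulMap_f e p) (exact_koszulMap_f e hS)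
    (homologyMap_koszulMap_zero e ι p w hp)
    (mono_koszulMap_f e ι 0 fun k hk _ hk0 => absurd hk0 (by omega))
  obtain ⟨ψ⟩ := nonempty_homology_zero_freeOn (K := K) x e
  exact ⟨φ ≪≫ ψ⟩

end Koszul

/-! ## Restriction to a subposet -/

section Restriction

variable {K : Type v} [Field K] {J : Type u} [PartialOrder J] {I : Type w} [PartialOrder I]
  (f : I ↪o J)

namespace freeOn

theorem supportedBelow_comp {n : ℕ} (x : Fin n → I) (j : I) :
    supportedBelow K (f ∘ x) (f j) = supportedBelow K x j := by
  ext c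
  exact forall_congr' fun i => by rw [Function.comp_apply, f.le_iff_le]

/-- The free functor with generators in a subposet restricts to the free functor with the same
generators. -/
def restrictIso {n : ℕ} (x : Fin n → I) :
    restrictAlong f.toOrderHom (freeOn K (f ∘ x)) ≅ freeOn K x where
  hom :=
    { app := fun j => FGModuleCat.homMk (V := (restrictAlong f.toOrderHom (freeOn K (f ∘ x))).obj j)
        (W := (freeOn K x).obj j) (Submodule.inclusion (supportedBelow_comp f x j).le)
      naturality := fun _ _ _ => rfl }
  inv :=
    { app := fun j => FGModuleCat.homMk (V := (freeOn K x).obj j)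
        (W := (restrictAlong f.toOrderHom (freeOn K (f ∘ x))).obj j)
        (Submodule.inclusion (supportedBelow_comp f x j).ge)
      naturality := fun _ _ _ => rfl }
  hom_inv_id := rfl
  inv_hom_id := rfl

theorem coeff_restrictIso_inv {n : ℕ} (x : Fin n → I) {j : I} (c : (freeOn K x).obj j) :
    coeff (f ∘ x) (((restrictIso f x).inv.app j).hom.hom c) = coeff x c := rfl

theorem IsRadical.restrict {n : ℕ} {x : Fin n → I} {M : J ⥤ FGModuleCat.{v} K}
    {p : freeOn K (f ∘ x) ⟶ M} (hp : IsRadical p) :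
    IsRadical ((restrictIso f x).inv ≫ Functor.whiskerLeft f.toOrderHom.monotone.functor p) := by
  intro i c hc
  rw [← coeff_restrictIso_inv f x c]
  exact hp i _ hc

end freeOn

namespace Resolution

variable [Finite I] {F : J ⥤ FGModuleCat.{v} K} {n : ℕ∞}

/-- The Koszul complex computes the Betti diagrams of a resolution by radical covers with
generators in the subposet, as long as it is left exact in low degrees. -/
theorem nonempty_homology_koszul_iso (P : Resolution F n) (i : ℕ) (hi : (i : ℕ∞) < n)
    (hP : ∀ k ≤ i, ∃ (l : ℕ) (x : Fin l → J) (e : P.obj (k + 1) ≅ freeOn K x),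
      (∀ t, x t ∈ Set.range f) ∧ freeOn.IsRadical (e.inv ≫ P.toSyz k))
    {l : ℕ} {y : Fin l → J} (ε : P.obj (i + 1) ≅ freeOn K y) {a : I} {m : ℕ}
    (e : Fin m ≃ parents a) (he : ∀ j < i, Koszul.HasGreatestAncestors e j) (j k : ℕ)
    (hjk : k + j = i) :
    Nonempty ((Koszul.koszulComplex (restrictAlong f.toOrderHom (P.syz k)) e).homology j ≅
      FGModuleCat.of K ({t : Fin l // y t = f a} → K)) := by
  classical
  -- Restriction to `I` is exact, and it preserves radical covers by free functors with generators
  -- in `I`.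
  have key : ∀ k ≤ i, ∃ (l : ℕ) (x : Fin l → I) (_ : P.obj (k + 1) ≅ freeOn K (f ∘ x))
      (ι : restrictAlong f.toOrderHom (P.syz (k + 1)) ⟶ freeOn K x)
      (p : freeOn K x ⟶ restrictAlong f.toOrderHom (P.syz k)) (w : ι ≫ p = 0),
      (ShortComplex.mk ι p w).ShortExact ∧ freeOn.IsRadical p := by
    intro k hk
    obtain ⟨l, x, e, hx, hr⟩ := hP k hk
    choose x' hx' using hx
    obtain rfl : f ∘ x' = x := funext hx'
    have hS := (P.shortExact_syz k (lt_of_le_of_lt (by exact_mod_cast hk) hi)).map_of_exact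
      ((Functor.whiskeringLeft I J (FGModuleCat.{v} K)).obj f.toOrderHom.monotone.functor)
    let E : restrictAlong f.toOrderHom (P.obj (k + 1)) ≅ freeOn K x' :=
      Functor.isoWhiskerLeft f.toOrderHom.monotone.functor e ≪≫ freeOn.restrictIso f x'
    have hp : E.inv ≫ Functor.whiskerLeft f.toOrderHom.monotone.functor (P.toSyz k) =
        (freeOn.restrictIso f x').inv ≫
          Functor.whiskerLeft f.toOrderHom.monotone.functor (e.inv ≫ P.toSyz k) := rfl
    have w : Functor.whiskerLeft f.toOrderHom.monotone.functor (P.syzToObj (k + 1)) ≫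
        Functor.whiskerLeft f.toOrderHom.monotone.functor (P.toSyz k) = 0 := by
      rw [← Functor.whiskerLeft_comp, P.syzToObj_toSyz k]
      rfl
    refine ⟨l, x', e, Functor.whiskerLeft _ (P.syzToObj (k + 1)) ≫ E.hom,
      E.inv ≫ Functor.whiskerLeft _ (P.toSyz k), ?_, ?_, ?_⟩
    · rw [Category.assoc, Iso.hom_inv_id_assoc, w]
    · exact ShortComplex.shortExact_of_iso
        (ShortComplex.isoMk (S₁ := ShortComplex.mk _ _ w)
          (Iso.refl _) E (Iso.refl _) (Category.id_comp _)
          ((Iso.hom_inv_id_assoc E _).trans (Category.comp_id _).symm)) hS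
    · rw [hp]
      exact hr.restrict f
  -- Each shift trades one homological degree for one syzygy, keeping `k + j = i`, until `H_0` of
  -- the `i`-th syzygy is reached.
  induction j generalizing k with
  | zero =>
    obtain rfl : k = i := hjk
    obtain ⟨l', x, e', ι, p, w, hS, hr⟩ := key k le_rfl
    obtain ⟨φ⟩ := Koszul.nonempty_homology_zero_iso_fiber e hS hr
    have hcard := freeOn.card_fiber_eq (e'.symm ≪≫ ε) (f a)
    obtain ⟨ψ⟩ := FGModuleCat.nonempty_iso_of_finrank_eq
      (V := FGModuleCat.of K ({t : Fin l' // x t = a} → K))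
      (W := FGModuleCat.of K ({t : Fin l // y t = f a} → K)) (by
        change Module.finrank K ({t : Fin l' // x t = a} → K) =
          Module.finrank K ({t : Fin l // y t = f a} → K)
        rw [Module.finrank_fintype_fun_eq_card, Module.finrank_fintype_fun_eq_card,
          ← Nat.card_eq_fintype_card, ← Nat.card_eq_fintype_card, ← hcard]
        exact Nat.card_congr (Equiv.subtypeEquivRight fun t => f.injective.eq_iff.symm))
    exact ⟨φ ≪≫ ψ⟩
  | succ j ih =>
    obtain ⟨l', x, e', ι, p, w, hS, hr⟩ := key k (by omega)
    obtain ⟨φ⟩ := Koszul.nonempty_homology_succ_iso e hS hr j (he j (by omega))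
    obtain ⟨ψ⟩ := ih (k + 1) (by omega)
    exact ⟨φ ≪≫ ψ⟩

end Resolution

/-- The support of the Betti diagrams, and their computation by Koszul complexes. -/
theorem IsSyzygyProperty.bettiDiagram [Finite I] {n : ℕ∞}
    {X : ℕ → (J ⥤ FGModuleCat.{v} K) → Prop} (hX : IsSyzygyProperty (Set.range f) n X)
    {F : J ⥤ FGModuleCat.{v} K} (hF : X 0 F) {i : ℕ} (hi : (i : ℕ∞) < n)
    {V : J → FGModuleCat.{v} K} (hV : IsBettiDiagram F i V) :
    famSupport V ⊆ Set.range f ∧ ∀ (a : I) (m : ℕ) (e : Fin m ≃ parents a),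
      (∀ j < i, Koszul.HasGreatestAncestors e j) →
      Nonempty (V (f a) ≅
        (Koszul.koszulComplex (restrictAlong f.toOrderHom F) e).homology i) := by
  classical
  obtain ⟨n', P, hi', hP, hPV⟩ := hV
  have hcov := fun (k : ℕ) (hk : k ≤ i) =>
    have hk : (k : ℕ∞) ≤ i := by exact_mod_cast hk
    (hX.syz hF hP k (hk.trans_lt hi) (hk.trans_lt hi')).2
  obtain ⟨l, y, ⟨ε⟩, hy⟩ := hPV.exists_iso
  constructor
  · intro a ha
    obtain ⟨l', x, e', hx, -⟩ := hcov i le_rfl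
    by_contra hne
    have : IsEmpty {t : Fin l' // x t = a} := ⟨fun t => hne (t.2 ▸ hx t.1)⟩
    have hcard := freeOn.card_fiber_eq (e'.symm ≪≫ ε) a
    rw [← hy, Nat.card_of_isEmpty] at hcard
    exact ha ((FGModuleCat.isZero_iff_subsingleton _).2
      (Module.finrank_zero_iff.1 hcard.symm))
  · intro a m e he
    obtain ⟨φ⟩ := P.nonempty_homology_koszul_iso f i hi' hcov ε e he i 0 (zero_add i)
    obtain ⟨ψ⟩ := FGModuleCat.nonempty_iso_of_finrank_eq (V := V (f a))
      (W := FGModuleCat.of K ({t : Fin l // y t = f a} → K)) (by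
        rw [hy]
        change _ = Module.finrank K ({t : Fin l // y t = f a} → K)
        rw [Module.finrank_fintype_fun_eq_card, Nat.card_eq_fintype_card])
    exact ⟨ψ ≪≫ φ.symm⟩

end Restriction

/-! ## Upper semilattices -/

section Semilattice

variable {J : Type u} [PartialOrder J]

/-- Take the join `c` in `I` of all `x` with `f x ≤ j`; as `f` preserves this join, `f c ≤ j` still.
-/
theorem hasGreatestBelow_range {I : Type w} [PartialOrder I] [Finite I] (f : I ↪o J)
    (hI : IsUpperSemilattice I) (hf : IsSemilatticeHom f) : HasGreatestBelow (Set.range f) := by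
  rintro j ⟨_, ⟨i, rfl⟩, hi⟩
  obtain ⟨c, hc⟩ := hI {x | f x ≤ j} (Set.toFinite _) ⟨i, hi⟩
  have hfc := hf _ (Set.toFinite _) ⟨i, hi⟩ c hc
  refine ⟨f c, ⟨⟨c, rfl⟩, hfc.2 ?_⟩, ?_⟩
  · rintro _ ⟨x, hx, rfl⟩
    exact hx
  · rintro _ ⟨⟨x, rfl⟩, hx⟩
    exact f.monotone (hc.1 hx)

/-- The set of coproducts of the non-empty subsets of `R`. -/
def joinClosure (R : Set J) : Set J := {c | ∃ S ⊆ R, S.Nonempty ∧ IsLUB S c}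

theorem subset_joinClosure (R : Set J) : R ⊆ joinClosure R := fun r hr =>
  ⟨{r}, Set.singleton_subset_iff.2 hr, Set.singleton_nonempty r, isLUB_singleton⟩

theorem finite_joinClosure {R : Set J} (hR : R.Finite) : (joinClosure R).Finite := by
  refine (hR.powerset.biUnion (t := fun S => {c | IsLUB S c}) fun S _ =>
    Set.Subsingleton.finite fun c hc d hd => hc.unique hd).subset ?_
  rintro c ⟨S, hS, -, hc⟩
  exact Set.mem_biUnion hS hc

/-- A join of joins is the join of the union, which is again a non-empty subset of `R`. -/
theorem exists_isLUB_joinClosure (hJ : IsUpperSemilattice J) {R : Set J} (hR : R.Finite)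
    (T : Set (joinClosure R)) (hT : T.Nonempty) :
    ∃ c : joinClosure R, IsLUB T c ∧ IsLUB (Subtype.val '' T) (c : J) := by
  choose S hSR hSn hS using fun t : joinClosure R => t.2
  have hU : ⋃ t ∈ T, S t ⊆ R := Set.iUnion₂_subset fun t _ => hSR t
  obtain ⟨t, ht⟩ := hT
  have hne : (⋃ t ∈ T, S t).Nonempty := (hSn t).mono (Set.subset_biUnion_of_mem ht)
  obtain ⟨c, hc⟩ := hJ _ (hR.subset hU) hne
  have hc' : IsLUB (Subtype.val '' T) c := by
    rw [isLUB_iff_le_iff] at hc ⊢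
    intro b
    rw [hc]
    constructor
    · rintro h _ ⟨t, ht, rfl⟩
      exact (hS t).2 fun s hs => h (Set.mem_biUnion ht hs)
    · intro h s hs
      obtain ⟨t, ht, hs⟩ := Set.mem_iUnion₂.1 hs
      exact ((hS t).1 hs).trans (h ⟨t, ht, rfl⟩)
  refine ⟨⟨c, _, hU, hne, hc⟩, ⟨fun t ht => hc'.1 ⟨t, ht, rfl⟩, fun b hb => hc'.2 ?_⟩, hc'⟩
  rintro _ ⟨t, ht, rfl⟩
  exact hb ht

theorem isUpperSemilattice_joinClosure (hJ : IsUpperSemilattice J) {R : Set J} (hR : R.Finite) :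
    IsUpperSemilattice (joinClosure R) := fun T _ hT =>
  (exists_isLUB_joinClosure hJ hR T hT).imp fun _ h => h.1

theorem isSemilatticeHom_joinClosure (hJ : IsUpperSemilattice J) {R : Set J} (hR : R.Finite) :
    IsSemilatticeHom (OrderEmbedding.subtype (· ∈ joinClosure R)) := by
  intro T _ hT c hc
  obtain ⟨d, hd, hd'⟩ := exists_isLUB_joinClosure hJ hR T hT
  rwa [hc.unique hd]

/-- A set of parents with an ancestor in a sub-semilattice bounds the parental dimension. -/
theorem le_parDim_of_index {A : Set J} (hA : IsUpperSemilattice A)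
    (hA' : IsSemilatticeHom (OrderEmbedding.subtype (· ∈ A))) {a : A} {m : ℕ}
    (e : Fin m ≃ parents a) {k : ℕ} (σ : Koszul.Index e k) : (k : ℕ∞) ≤ parDim (a : J) := by
  classical
  have hinj : Function.Injective fun j : Fin k => ((e (σ.emb j) : A) : J) :=
    Subtype.val_injective.comp (Subtype.val_injective.comp (e.injective.comp σ.emb.injective))
  let U : Finset J := Finset.univ.image fun j : Fin k => ((e (σ.emb j) : A) : J)
  have hcard : U.card = k := by rw [Finset.card_image_of_injective _ hinj, Finset.card_fin]
  have hU : U ∈ parDimSets (a : J) := by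
    refine ⟨?_, ?_, ?_⟩
    · intro y hy
      obtain ⟨j, -, rfl⟩ := Finset.mem_image.1 hy
      exact (e (σ.emb j)).2.lt
    · obtain ⟨z, hz⟩ := σ.nonempty
      refine ⟨z, fun y hy => ?_⟩
      obtain ⟨j, -, rfl⟩ := Finset.mem_image.1 hy
      exact hz ⟨j, rfl⟩
    · intro y hy z hz hyz
      obtain ⟨j, -, rfl⟩ := Finset.mem_image.1 hy
      obtain ⟨l, -, rfl⟩ := Finset.mem_image.1 hz
      have hj := (e (σ.emb j)).2
      have hl := (e (σ.emb l)).2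
      generalize (e (σ.emb j) : A) = y at *
      generalize (e (σ.emb l) : A) = z at *
      refine ⟨?_, fun b hb hba => ?_⟩
      · rintro _ (rfl | rfl)
        · exact hj.le
        · exact hl.le
      · obtain ⟨c, hc⟩ := hA {y, z} (Set.toFinite _) ⟨y, Or.inl rfl⟩
        have hcJ := hA' {y, z} (Set.toFinite _) ⟨y, Or.inl rfl⟩ c hc
        have hca : c ≤ a := hc.2 (by
          rintro _ (rfl | rfl)
          · exact hj.le
          · exact hl.le)
        have hcb : (c : J) ≤ b := hcJ.2 (by
          rintro _ ⟨t, rfl | rfl, rfl⟩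
          · exact hb (Or.inl rfl)
          · exact hb (Or.inr rfl))
        obtain hcy | hcy := hj.eq_or_eq (hc.1 (Or.inl rfl)) hca
        · have hzy : z ≤ y := hcy ▸ hc.1 (Or.inr rfl)
          obtain h | h := hl.eq_or_eq hzy hj.le
          · exact absurd (congrArg Subtype.val h) hyz
          · exact absurd h hj.ne
        · rwa [hcy] at hcb
  rw [← hcard]
  exact le_iSup₂ (f := fun (U : Finset J) (_ : U ∈ parDimSets (a : J)) => (U.card : ℕ∞)) U hU

end Semilattice

theorem Koszul.isZero_homology_of_isEmpty {K : Type v} [Field K] {I : Type u} [PartialOrder I]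
    [Finite I] (G : I ⥤ FGModuleCat.{v} K) {a : I} {m : ℕ} (e : Fin m ≃ parents a) (k : ℕ)
    (h : IsEmpty (Koszul.Index e (k + 1))) :
    IsZero ((Koszul.koszulComplex G e).homology (k + 1)) := by
  have hX : IsZero ((Koszul.koszulComplex G e).X (k + 1)) := by
    rw [IsZero.iff_id_eq_zero]
    exact Koszul.term_hom_ext G e fun σ => h.elim σ
  have hE : (Koszul.koszulComplex G e).ExactAt (k + 1) :=
    ShortComplex.exact_of_isZero_X₂ _ hX
  exact hE.isZero_homology

end

/-! ### Proof of the three statements -/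

theorem mainTheorem12 {K : Type v} [Field K] {J : Type u} [PartialOrder J]
    (F : J ⥤ FGModuleCat.{v} K) :
    -- (1)
    (∀ (n : ℕ∞), 1 ≤ n → ∀ (I : Type w) [PartialOrder I] [Finite I] (f : I ↪o J),
      (∃ P : Resolution F n, ∀ i : ℕ, (i : ℕ∞) < n →
        IsDiscretisedBy f.toOrderHom (P.complex.X i)) →
      HasMinimalResolution F n ∧
      ∀ (i : ℕ) (V : J → FGModuleCat.{v} K), (i : ℕ∞) < n → IsBettiDiagram F i V →
        famSupport V ⊆ Set.range f ∧
        (i < 3 → ∀ (a : I) (m : ℕ) (e : Fin m ≃ parents a),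
          Nonempty (V (f a) ≅
            (Koszul.koszulComplex (restrictAlong f.toOrderHom F) e).homology i))) ∧
    -- (2)
    (∀ (I : Type w) [PartialOrder I] [Finite I] (f : I ↪o J),
      IsUpperSemilattice I → IsSemilatticeHom f → IsDiscretisedBy f.toOrderHom F →
      IsResolvable F ⊤ ∧ HasMinimalResolution F ⊤ ∧
      ∀ (i : ℕ) (V : J → FGModuleCat.{v} K), IsBettiDiagram F i V →
        famSupport V ⊆ Set.range f ∧
        ∀ (a : I) (m : ℕ) (e : Fin m ≃ parents a),
          Nonempty (V (f a) ≅
            (Koszul.koszulComplex (restrictAlong f.toOrderHom F) e).homology i)) ∧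
    -- (3)
    (IsUpperSemilattice J → IsTame F →
      IsResolvable F ⊤ ∧ HasMinimalResolution F ⊤ ∧
      ∀ (i : ℕ) (V : J → FGModuleCat.{v} K), IsBettiDiagram F i V →
        ∀ a : J, parDim a < (i : ℕ∞) → IsZero (V a)) := by
  refine ⟨?_, ?_, ?_⟩
  · rintro n hn I _ _ f ⟨R, hR⟩
    have hX := R.isSyzygyProperty_retract (A := Set.range f) fun k hk => (hR k hk).exists_epi
    have hF : Nonempty (Retract F (R.syz 0)) := ⟨Retract.refl F⟩
    refine ⟨hX.hasMinimalResolution hF hn, fun i V hi hV => ?_⟩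
    obtain ⟨hsupp, hkos⟩ := hX.bettiDiagram f hF hi hV
    exact ⟨hsupp, fun hi3 a m e => hkos a m e fun j hj =>
      (Koszul.hasGreatestAncestors_one e).mono e (by omega)⟩
  · intro I _ _ f hI hf hF
    have hX := isSyzygyProperty_isDeterminedOn (K := K) (hasGreatestBelow_range f hI hf)
      (Set.finite_range f)
    have hF := hF.isDeterminedOn (A := Set.range f) subset_rfl
    obtain ⟨P, hP⟩ := hX.hasMinimalResolution hF le_top
    refine ⟨⟨P⟩, ⟨P, hP⟩, fun i V hV => ?_⟩
    obtain ⟨hsupp, hkos⟩ := hX.bettiDiagram f hF (ENat.natCast_lt_top i) hV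
    exact ⟨hsupp, fun a m e => hkos a m e fun j _ =>
      Koszul.hasGreatestAncestors_of_isUpperSemilattice e hI j⟩
  · rintro hJ ⟨I, _, _, g, hg⟩
    have hR : (Set.range g).Finite := Set.finite_range g
    -- The map `g` need be neither injective nor a homomorphism; only its image matters, and the
    -- inclusion of the join closure of this image is a homomorphism.
    let A := joinClosure (Set.range g)
    let f : A ↪o J := OrderEmbedding.subtype (· ∈ A)
    have : Finite A := finite_joinClosure hR
    have hA : IsUpperSemilattice A := isUpperSemilattice_joinClosure hJ hR
    have hf : IsSemilatticeHom f := isSemilatticeHom_joinClosure hJ hR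
    have hrange : Set.range f = A := Subtype.range_coe
    have hX := isSyzygyProperty_isDeterminedOn (K := K) (hasGreatestBelow_range f hA hf)
      (Set.finite_range f)
    have hF : IsDeterminedOn (Set.range f) F :=
      hg.isDeterminedOn (by rw [hrange]; exact subset_joinClosure _)
    obtain ⟨P, hP⟩ := hX.hasMinimalResolution hF le_top
    refine ⟨⟨P⟩, ⟨P, hP⟩, fun i V hV a ha => ?_⟩
    obtain ⟨hsupp, hkos⟩ := hX.bettiDiagram f hF (ENat.natCast_lt_top i) hV
    by_cases haA : a ∈ A
    · obtain ⟨m, ⟨e⟩⟩ := Finite.exists_equiv_fin (parents (⟨a, haA⟩ : A))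
      obtain ⟨φ⟩ := hkos ⟨a, haA⟩ m e.symm fun j _ =>
        Koszul.hasGreatestAncestors_of_isUpperSemilattice e.symm hA j
      obtain _ | i := i
      · exact absurd ha (by simp)
      · refine IsZero.of_iso (Koszul.isZero_homology_of_isEmpty _ _ i ⟨fun σ => ?_⟩) φ
        exact absurd (le_parDim_of_index hA hf e.symm σ) ha.not_ge
    · by_contra h
      exact haA (hrange ▸ hsupp h)
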